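/- Let $k$ be a commutative ring and let $D$ be an oriented singular tangle diagram in $\mathbb R\times[0,1]$, i.e. a generic oriented tangle diagram each of whose vertices is a positive crossing, a negative crossing or a double point. Fix a total order on the vertices and a checkerboard colouring $\chi$ of the complement of $D$. **The category.** For oriented $0$-manifolds $Y_0,Y_1$, $\mathcal C(Y_0,Y_1)$ is the additive closure ($\mathrm{Mat}$) of the $k$-linear category whose objects are the $1$-dimensional cobordisms $Y_0\to Y_1$ and whose morphisms are $k$-linear combinations of diffeomorphism classes rel boundary of oriented $2$-bordisms, modulo the relations $S\amalg S^2=0$, $S\amalg T^2=2S$ and $4Tu$. For a complex $W$ put $W[m]^i=W^{i-m}$, $d_{W[m]}=(-1)^m d_W$, and for $f:X\to Y$ let $\operatorname{Cone}(f)^i=Y^i\oplus X^{i+1}$ be the mapping cone. **The bracket complex.** If $D$ has no double points, $⟦D^\chi⟧$ is the complex over $\mathcal C(\partial^-D^\chi,\partial^+D^\chi)$ with $⟦D^\chi⟧^i=\bigoplus_{|s|=i}D_s^\chi$, the sum being over the sets $s$ of crossings ($c\in s$ receives its $1$-smoothing, $c\notin s$ its $0$-smoothing; the smoothings are oriented as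 boundaries of the black regions); the component of the differential from $s$ to $s\cup\{c\}$, $c\notin s$, is $(-1)^{\#\{c'\in s\,:\,c'<c\}}$ times the saddle at $c$. **The genus-one morphism.** For a crossing $c$, write $D_-$, $D_+$ for the diagrams in which it is negative, resp. positive. The genus-one morphism $\widehat\Phi_c:⟦D_-^\chi⟧\to⟦D_+^\chi⟧[1]$ maps the summand of $s\ni c$ to that of $s\setminus\{c\}$ (both have at $c$ the smoothing that respects the orientation of the tangle) by $(-1)^{\#\{c'\in s\,:\,c'<c\}}\Phi$, where $\Phi$ is the cylinder with a tube joining the two strands at $c$ minus the cylinder with a handle attached to the left strand at $c$; it vanishes on the summands with $c\notin s$. **Singular diagrams.** For a set $\mathfrak r$ of double points of $D$ let $D_{\mathfrak r}$ be the diagram in which the double points in $\mathfrak r$ are replaced by positive crossings and the other ones by negative crossings. Then $$⟦D^\chi⟧=\bigoplus_{\mathfrak r}⟦D_{\mathfrak r}^\chi⟧[2|\mathfrak r|],$$ with differential on the summand of $\mathfrak r$ equal to $d_{D_{\mathfrak r}}+\sum_{b\notin\mathfrak r}\widehat\Phi_{\mathfrak r,b}$, where $\widehat\Phi_{\mathfrak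 r,b}:⟦D_{\mathfrak r}^\chi⟧\to⟦D_{\mathfrak r\cup\{b\}}^\chi⟧[1]$ is the genus-one morphism at $b$. The universal Khovanov complex is $\mathrm{Kh}(D)=⟦D^{\chi_w}⟧[-n_--2n_\times]$, where $\chi_w$ is the colouring whose leftmost (negatively unbounded) region is white, $n_-$ is the number of negative crossings and $n_\times$ the number of double points. **Claim.** Let $b$ be a double point of $D$, and let $D^{(-)}$, $D^{(+)}$ be obtained from $D$ by replacing $b$ by a negative, resp. positive, crossing. The genus-one morphisms at $b$ of all resolutions form chain maps $\widehat\Phi:⟦D^{(-),\chi}⟧\to⟦D^{(+),\chi}⟧[1]$ and $\widehat\Phi:\mathrm{Kh}(D^{(-)})\to\mathrm{Kh}(D^{(+)})$, and the following hold. 1. For every checkerboard colouring $\chi$ there is an isomorphism of complexes $$⟦D^\chi⟧\cong\operatorname{Cone}\left(⟦D^{(-),\chi}⟧\xrightarrow{\widehat\Phi}⟦D^{(+),\chi}⟧[1]\right)[1]$$ which carries the inclusion $⟦D^{(+),\chi}⟧[2]\to⟦D^\chi⟧$ (of the summands with $b\in\mathfrak r$) and the projection $⟦D^\chi⟧\to⟦D^{(-),\chi}⟧$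 (to the summands with $b\notin\mathfrak r$) to the canonical morphisms into and out of the cone (the morphism $\operatorname{Cone}(f)\to X[-1]$ being taken to be minus the projection). 2. There is an isomorphism of complexes $$\mathrm{Kh}(D)\cong\operatorname{Cone}\left(\mathrm{Kh}(D^{(-)})\xrightarrow{\widehat\Phi}\mathrm{Kh}(D^{(+)})\right)$$ such that, with the morphisms it induces, the following hold. - $\mathrm{Kh}(D^{(-)})\xrightarrow{\widehat\Phi}\mathrm{Kh}(D^{(+)})\to\mathrm{Kh}(D)\to\mathrm{Kh}(D^{(-)})[-1]$ is a distinguished triangle in the homotopy category. - For every additive functor $Z:\mathcal C(\partial^-D^{\chi_w},\partial^+D^{\chi_w})\to\mathcal A$ to an abelian category there is a long exact sequence $$\cdots\to H^i(Z\,\mathrm{Kh}(D^{(-)}))\xrightarrow{\widehat\Phi_*}H^i(Z\,\mathrm{Kh}(D^{(+)}))\to H^i(Z\,\mathrm{Kh}(D))\to H^{i+1}(Z\,\mathrm{Kh}(D^{(-)}))\xrightarrow{\widehat\Phi_*}\cdots.$$ 3. In the Grothendieck group of the triangulated homotopy category of bounded complexes over $\mathcal C(\partial^-D^{\chi_w},\partial^+D^{\chi_w})$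 one has $$[\mathrm{Kh}(D)]=[\mathrm{Kh}(D^{(+)})]-[\mathrm{Kh}(D^{(-)})].$$ -/

import Mathlib

set_option linter.unusedSectionVars false
set_option linter.unusedVariables false

open CategoryTheory

namespace UKh

/-- A closed oriented `0`-manifold: a finite set of points, each labelled `+` or `-`. -/
structure Points where
  pos : Type
  neg : Type
  [finPos : Finite pos]
  [finNeg : Finite neg]

attribute [instance] Points.finPos Points.finNeg

/-- The boundary points at which an oriented cobordism `W : Y₀ → Y₁`
(with `∂W = -Y₀ ⊔ Y₁`) starts. -/
abbrev Start (Y₀ Y₁ : Points) : Type := Y₀.pos ⊕ Y₁.neg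

/-- The boundary points at which an oriented cobordism `W : Y₀ → Y₁` stops. -/
abbrev Stop (Y₀ Y₁ : Points) : Type := Y₀.neg ⊕ Y₁.pos

/-- The boundary points together with a set `E` of interior points. -/
abbrev Pt (Y₀ Y₁ : Points) (E : Type) : Type := (Start Y₀ Y₁ ⊕ E) ⊕ Stop Y₀ Y₁

/-- An interior or final point, as a point. -/
def arr {Y₀ Y₁ : Points} {E : Type} : E ⊕ Stop Y₀ Y₁ → Pt Y₀ Y₁ E :=
  Sum.elim (fun e => Sum.inl (Sum.inr e)) Sum.inr

/-- A cobordism `W : Y₀ → Y₁` of oriented `0`-manifolds, i.e. a compact oriented `1`-manifold with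
`∂W = -Y₀ ⊔ Y₁`.  It is subdivided by finitely many interior points `E` into oriented edges;
`next` sends the tail of each edge to its head.  As `next` is a bijection, each boundary point is
the end of exactly one edge and each interior point has one edge arriving and one leaving, so
that every component is an oriented circle or an oriented arc from a start to a stop. -/
structure Curve (Y₀ Y₁ : Points) where
  E : Type
  [fin : Finite E]
  next : Start Y₀ Y₁ ⊕ E ≃ E ⊕ Stop Y₀ Y₁

attribute [instance] Curve.fin

variable {Y₀ Y₁ : Points}

/-- `p` and `q` are the tail and the head of an edge. -/
def Step {E : Type} (n : Start Y₀ Y₁ ⊕ E ≃ E ⊕ Stop Y₀ Y₁) (p q : Pt Y₀ Y₁ E) : Prop :=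
  ∃ z, p = Sum.inl z ∧ q = arr (n z)

/-- The starting points, each with weight one. -/
noncomputable def startWeight (Y₀ Y₁ : Points) (E : Type) : Pt Y₀ Y₁ E →₀ ℤ :=
  Finsupp.mapDomain (fun i : Start Y₀ Y₁ => Sum.inl (Sum.inl i))
    (Finsupp.equivFunOnFinite.symm (fun _ => 1))

namespace Curve

/-- The set of connected components. -/
def Comp (W : Curve Y₀ Y₁) : Type := Quot (Step W.next)

instance (W : Curve Y₀ Y₁) : Finite W.Comp := inferInstanceAs (Finite (Quot _))

/-- The component of a point. -/
def toComp (W : Curve Y₀ Y₁) (p : Pt Y₀ Y₁ W.E) : W.Comp := Quot.mk _ p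

/-- The component of a boundary point. -/
def bd (W : Curve Y₀ Y₁) : Start Y₀ Y₁ ⊕ Stop Y₀ Y₁ → W.Comp :=
  Sum.elim (fun i => W.toComp (Sum.inl (Sum.inl i))) (fun o => W.toComp (Sum.inr o))

/-- The Euler characteristics of the components, i.e. the number of starting points on each:
one for an arc, zero for a circle. -/
noncomputable def euler (W : Curve Y₀ Y₁) : W.Comp →₀ ℤ :=
  Finsupp.mapDomain W.toComp (startWeight Y₀ Y₁ W.E)

/-- The disjoint union with a circle. -/
def addCircle (W : Curve Y₀ Y₁) : Curve Y₀ Y₁ where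
  E := W.E ⊕ Unit
  next := (Equiv.sumAssoc _ _ _).symm.trans <| (Equiv.sumCongr W.next (Equiv.refl _)).trans <|
    (Equiv.sumAssoc _ _ _).trans <| (Equiv.sumCongr (Equiv.refl _) (Equiv.sumComm _ _)).trans
      (Equiv.sumAssoc _ _ _).symm

/-- The inclusion of the components of `W` into those of `W ⊔ S¹`. -/
def inclComp (W : Curve Y₀ Y₁) : W.Comp → W.addCircle.Comp :=
  Quot.map (Sum.map (Sum.map id Sum.inl) id) (by
    rintro _ _ ⟨z, rfl, rfl⟩
    refine ⟨Sum.map id Sum.inl z, rfl, ?_⟩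
    have h : W.addCircle.next (Sum.map id Sum.inl z) = Sum.map Sum.inl id (W.next z) := by
      rcases z with z | z
      · change (Equiv.sumAssoc _ _ _).symm (Sum.map id Sum.swap
          (Equiv.sumAssoc _ _ _ (Sum.inl (W.next (Sum.inl z))))) = _
        generalize W.next (Sum.inl z) = y
        rcases y with y | y <;> rfl
      · change (Equiv.sumAssoc _ _ _).symm (Sum.map id Sum.swap
          (Equiv.sumAssoc _ _ _ (Sum.inl (W.next (Sum.inr z))))) = _
        generalize W.next (Sum.inr z) = y
        rcases y with y | y <;> rfl
    rw [h]
    rcases W.next z with y | y <;> rfl)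

/-- The added circle. -/
def circle (W : Curve Y₀ Y₁) : W.addCircle.Comp := W.addCircle.toComp (Sum.inl (Sum.inr (Sum.inr ())))

end Curve

/-- Combinatorial data of a compact oriented surface `S : W → W'` with corners: its set `K` of
connected components, the components on which those of `W` and of `W'` lie (the boundary part
`(Y₀ ⊔ Y₁) × [0,1]` being accounted for by the field `bd`), and the Euler characteristic of each
component.  By the classification of surfaces these data, up to bijections of `K`, determine the
`2`-bordism up to orientation preserving diffeomorphisms relative to the boundary.  The data which
do come from surfaces are singled out by `IsBordism` below. -/
structure Surface (W W' : Curve Y₀ Y₁) where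
  K : Type
  [fin : Finite K]
  src : W.Comp → K
  tgt : W'.Comp → K
  bd : ∀ y, src (W.bd y) = tgt (W'.bd y)
  χ : K →₀ ℤ

attribute [instance] Surface.fin

namespace Surface

/-- Diffeomorphism relative to the boundary. -/
def Rel {W W' : Curve Y₀ Y₁} (S T : Surface W W') : Prop :=
  ∃ e : S.K ≃ T.K, (∀ c, e (S.src c) = T.src c) ∧ (∀ c, e (S.tgt c) = T.tgt c) ∧
    Finsupp.mapDomain e S.χ = T.χ

lemma mapDomain_sub {A B : Type} (f : A → B) (u v : A →₀ ℤ) :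
    Finsupp.mapDomain f (u - v) = Finsupp.mapDomain f u - Finsupp.mapDomain f v :=
  map_sub (Finsupp.mapDomain.addMonoidHom f) u v

instance setoid (W W' : Curve Y₀ Y₁) : Setoid (Surface W W') where
  r := Rel
  iseqv :=
    { refl := fun S => ⟨Equiv.refl _, fun _ => rfl, fun _ => rfl, Finsupp.mapDomain_id⟩
      symm := by
        rintro S T ⟨e, h1, h2, h3⟩
        refine ⟨e.symm, fun c => ?_, fun c => ?_, ?_⟩
        · rw [← h1, e.symm_apply_apply]
        · rw [← h2, e.symm_apply_apply]
        · rw [← h3, ← Finsupp.mapDomain_comp]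
          simp [Finsupp.mapDomain_id]
      trans := by
        rintro S T U ⟨e, h1, h2, h3⟩ ⟨f, g1, g2, g3⟩
        refine ⟨e.trans f, fun c => ?_, fun c => ?_, ?_⟩
        · simp [h1, g1]
        · simp [h2, g2]
        · rw [← g3, ← h3, ← Finsupp.mapDomain_comp]
          rfl }

variable {W W' W'' W''' : Curve Y₀ Y₁}

/-- The identification of components when two surfaces are glued along `W'`. -/
def GlueRel (S : Surface W W') (T : Surface W' W'') (a b : S.K ⊕ T.K) : Prop :=
  ∃ c, a = Sum.inl (S.tgt c) ∧ b = Sum.inr (T.src c)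

/-- Gluing along `W'`; the Euler characteristic is `χ(S) + χ(T) - χ(W')`. -/
noncomputable def glue (S : Surface W W') (T : Surface W' W'') : Surface W W'' where
  K := Quot (GlueRel S T)
  src c := Quot.mk _ (Sum.inl (S.src c))
  tgt c := Quot.mk _ (Sum.inr (T.tgt c))
  bd y := by
    rw [S.bd, ← T.bd]
    exact Quot.sound ⟨_, rfl, rfl⟩
  χ := Finsupp.mapDomain (fun x => Quot.mk _ (Sum.inl x)) S.χ +
    Finsupp.mapDomain (fun x => Quot.mk _ (Sum.inr x)) T.χ -
    Finsupp.mapDomain (fun c => Quot.mk _ (Sum.inl (S.tgt c))) W'.euler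

/-- The trivial surface `W × [0,1]`. -/
noncomputable def cylinder (W : Curve Y₀ Y₁) : Surface W W where
  K := W.Comp
  src := id
  tgt := id
  bd _ := rfl
  χ := W.euler

lemma glue_rel {S S' : Surface W W'} {T T' : Surface W' W''} (hS : Rel S S') (hT : Rel T T') :
    Rel (S.glue T) (S'.glue T') := by
  obtain ⟨e, h1, h2, h3⟩ := hS
  obtain ⟨f, g1, g2, g3⟩ := hT
  refine ⟨⟨Quot.map (Sum.map e f) ?_, Quot.map (Sum.map e.symm f.symm) ?_, ?_, ?_⟩, ?_, ?_, ?_⟩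
  · rintro _ _ ⟨c, rfl, rfl⟩
    exact ⟨c, by simp [h2], by simp [g1]⟩
  · rintro _ _ ⟨c, rfl, rfl⟩
    exact ⟨c, by simp [← h2], by simp [← g1]⟩
  · rintro ⟨x | x⟩ <;> simp [Quot.map] <;> rfl
  · rintro ⟨x | x⟩ <;> simp [Quot.map] <;> rfl
  · intro c
    change Quot.mk _ (Sum.inl (e (S.src c))) = _
    rw [h1]; rfl
  · intro c
    change Quot.mk _ (Sum.inr (f (T.tgt c))) = _
    rw [g2]; rfl
  · simp only [glue]
    rw [← h3, ← g3]
    simp only [mapDomain_sub, Finsupp.mapDomain_add, ← Finsupp.mapDomain_comp]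
    congr 1
    congr 1
    funext c
    change Quot.mk _ (Sum.inl (e (S.tgt c))) = _
    rw [h2]

lemma cylinder_glue (S : Surface W W') : Rel ((cylinder W).glue S) S := by
  refine ⟨⟨Quot.lift (Sum.elim S.src id) ?_, fun x => Quot.mk _ (Sum.inr x), ?_, ?_⟩, ?_, ?_, ?_⟩
  · rintro _ _ ⟨c, rfl, rfl⟩; rfl
  · rintro ⟨x | x⟩
    · symm; exact Quot.sound ⟨x, rfl, rfl⟩
    · rfl
  · intro x; rfl
  · intro c; rfl
  · intro c; rfl
  · simp only [glue]
    rw [mapDomain_sub, Finsupp.mapDomain_add,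
      ← Finsupp.mapDomain_comp, ← Finsupp.mapDomain_comp, ← Finsupp.mapDomain_comp]
    have : Finsupp.mapDomain (id : S.K → S.K) S.χ = S.χ := Finsupp.mapDomain_id
    conv_rhs => rw [← this]
    exact add_sub_cancel_left _ _

lemma glue_cylinder (S : Surface W W') : Rel (S.glue (cylinder W')) S := by
  refine ⟨⟨Quot.lift (Sum.elim id S.tgt) ?_, fun x => Quot.mk _ (Sum.inl x), ?_, ?_⟩, ?_, ?_, ?_⟩
  · rintro _ _ ⟨c, rfl, rfl⟩; rfl
  · rintro ⟨x | x⟩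
    · rfl
    · exact Quot.sound ⟨x, rfl, rfl⟩
  · intro x; rfl
  · intro c; rfl
  · intro c; rfl
  · simp only [glue]
    rw [mapDomain_sub, Finsupp.mapDomain_add,
      ← Finsupp.mapDomain_comp, ← Finsupp.mapDomain_comp, ← Finsupp.mapDomain_comp]
    have : Finsupp.mapDomain (id : S.K → S.K) S.χ = S.χ := Finsupp.mapDomain_id
    conv_rhs => rw [← this]
    exact add_sub_cancel_right _ _

lemma glue_assoc (S : Surface W W') (T : Surface W' W'') (U : Surface W'' W''') :
    Rel ((S.glue T).glue U) (S.glue (T.glue U)) := by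
  refine ⟨⟨Quot.lift (Sum.elim (Quot.lift (Sum.elim (fun x => Quot.mk _ (Sum.inl x))
      (fun x => Quot.mk _ (Sum.inr (Quot.mk _ (Sum.inl x))))) ?_)
      (fun x => Quot.mk _ (Sum.inr (Quot.mk _ (Sum.inr x))))) ?_,
    Quot.lift (Sum.elim (fun x => Quot.mk _ (Sum.inl (Quot.mk _ (Sum.inl x))))
      (Quot.lift (Sum.elim (fun x => Quot.mk _ (Sum.inl (Quot.mk _ (Sum.inr x))))
      (fun x => Quot.mk _ (Sum.inr x))) ?_)) ?_, ?_, ?_⟩, ?_, ?_, ?_⟩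
  · rintro _ _ ⟨c, rfl, rfl⟩
    exact Quot.sound ⟨c, rfl, rfl⟩
  · rintro _ _ ⟨c, rfl, rfl⟩
    exact congrArg (fun t => Quot.mk _ (Sum.inr t)) (Quot.sound ⟨c, rfl, rfl⟩)
  · rintro _ _ ⟨c, rfl, rfl⟩
    exact Quot.sound ⟨c, rfl, rfl⟩
  · rintro _ _ ⟨c, rfl, rfl⟩
    exact congrArg (fun t => Quot.mk _ (Sum.inl t)) (Quot.sound ⟨c, rfl, rfl⟩)
  · rintro ⟨⟨⟨x | x⟩⟩ | x⟩ <;> rfl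
  · rintro ⟨x | ⟨⟨x | x⟩⟩⟩ <;> rfl
  · intro c; rfl
  · intro c; rfl
  · simp only [glue, mapDomain_sub, Finsupp.mapDomain_add, ← Finsupp.mapDomain_comp]
    have key : ∀ (A B C D E : (S.glue (T.glue U)).K →₀ ℤ),
      A + B - E + C - D = A + (B + C - D) - E := by
      intro A B C D E
      abel
    exact key _ _ _ _ _

end Surface

/-- Curves with boundary `-Y₀ ⊔ Y₁`, and surface data up to isomorphism between them. -/
noncomputable instance : Category (Curve Y₀ Y₁) where
  Hom W W' := Quotient (Surface.setoid W W')
  id W := Quotient.mk _ (Surface.cylinder W)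
  comp f g := Quotient.map₂ Surface.glue (fun _ _ h _ _ h' => Surface.glue_rel h h') f g
  id_comp := by rintro _ _ ⟨S⟩; exact Quotient.sound (Surface.cylinder_glue S)
  comp_id := by rintro _ _ ⟨S⟩; exact Quotient.sound (Surface.glue_cylinder S)
  assoc := by rintro _ _ _ _ ⟨S⟩ ⟨T⟩ ⟨U⟩; exact Quotient.sound (Surface.glue_assoc S T U)


/-! ### Surfaces built on a common set of points -/

section Built

variable {E : Type}

/-- `p` and `q` lie on a common edge, or are joined by the further relation `T`. -/
def Join (n : Start Y₀ Y₁ ⊕ E ≃ E ⊕ Stop Y₀ Y₁) (T : Pt Y₀ Y₁ E → Pt Y₀ Y₁ E → Prop)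
    (p q : Pt Y₀ Y₁ E) : Prop :=
  Step n p q ∨ T p q

/-- Every edge of `n'` lies in one class of the relation generated by the edges of `n` and `T`. -/
def Compat (n n' : Start Y₀ Y₁ ⊕ E ≃ E ⊕ Stop Y₀ Y₁) (T : Pt Y₀ Y₁ E → Pt Y₀ Y₁ E → Prop) : Prop :=
  ∀ z, Relation.EqvGen (Join n T) (Sum.inl z) (arr (n' z))

/-- The surface data obtained from the cylinder over the curve `n` by joining components as
prescribed by `T` and changing the Euler characteristics by the weights `a` on the points. -/
noncomputable def built [Finite E] (n n' : Start Y₀ Y₁ ⊕ E ≃ E ⊕ Stop Y₀ Y₁)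
    (T : Pt Y₀ Y₁ E → Pt Y₀ Y₁ E → Prop) (h : Compat n n' T) (a : Pt Y₀ Y₁ E →₀ ℤ) :
    Surface (Curve.mk E n) (Curve.mk E n') where
  K := Quot (Join n T)
  src := Quot.map id (fun _ _ hs => Or.inl hs)
  tgt := Quot.lift (Quot.mk _) (by
    rintro _ _ ⟨z, rfl, rfl⟩
    exact Quot.eqvGen_sound (h z))
  bd := by rintro (y | y) <;> rfl
  χ := Finsupp.mapDomain (Quot.mk _) (startWeight Y₀ Y₁ E + a)

/-- The curve `n'` arises from `n` by an oriented saddle move (band surgery) at the edges leaving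
`x` and `y`: these are cut, and reconnected the other way. -/
def IsSaddle (n n' : Start Y₀ Y₁ ⊕ E ≃ E ⊕ Stop Y₀ Y₁) (x y : Start Y₀ Y₁ ⊕ E) : Prop :=
  x ≠ y ∧ n' x = n y ∧ n' y = n x ∧ ∀ z, z ≠ x → z ≠ y → n' z = n z

/-- The relation joining exactly the points `x` and `y`. -/
def JoinTwo (x y : Start Y₀ Y₁ ⊕ E) (p q : Pt Y₀ Y₁ E) : Prop := p = Sum.inl x ∧ q = Sum.inl y

lemma IsSaddle.compat {n n' : Start Y₀ Y₁ ⊕ E ≃ E ⊕ Stop Y₀ Y₁} {x y : Start Y₀ Y₁ ⊕ E}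
    (h : IsSaddle n n' x y) : Compat n n' (JoinTwo x y) := by
  intro z
  have hxy : Relation.EqvGen (Join n (JoinTwo x y)) (Sum.inl x) (Sum.inl y) :=
    .rel _ _ (Or.inr ⟨rfl, rfl⟩)
  by_cases hx : z = x
  · subst hx
    rw [h.2.1]
    exact hxy.trans _ _ _ (.rel _ _ (Or.inl ⟨y, rfl, rfl⟩))
  by_cases hy : z = y
  · subst hy
    rw [h.2.2.1]
    exact (hxy.symm _ _).trans _ _ _ (.rel _ _ (Or.inl ⟨x, rfl, rfl⟩))
  · rw [h.2.2.2 z hx hy]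
    exact .rel _ _ (Or.inl ⟨z, rfl, rfl⟩)

lemma compat_self (n : Start Y₀ Y₁ ⊕ E ≃ E ⊕ Stop Y₀ Y₁) : Compat n n (fun _ _ => False) :=
  fun z => .rel _ _ (Or.inl ⟨z, rfl, rfl⟩)

/-- The saddle surface: the components of `x` and `y` are joined by a band. -/
noncomputable def saddleSurface [Finite E] (n n' : Start Y₀ Y₁ ⊕ E ≃ E ⊕ Stop Y₀ Y₁)
    (x y : Start Y₀ Y₁ ⊕ E) (h : IsSaddle n n' x y) : Surface (Curve.mk E n) (Curve.mk E n') :=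
  built n n' (JoinTwo x y) h.compat (Finsupp.single (Sum.inl x) (-1))

/-- The cylinder with a handle attached to the sheet over the component of `x`. -/
noncomputable def handleSurface [Finite E] (n : Start Y₀ Y₁ ⊕ E ≃ E ⊕ Stop Y₀ Y₁)
    (x : Start Y₀ Y₁ ⊕ E) : Surface (Curve.mk E n) (Curve.mk E n) :=
  built n n (fun _ _ => False) (compat_self n) (Finsupp.single (Sum.inl x) (-2))

end Built

namespace Surface

variable {W W' : Curve Y₀ Y₁}

/-- The mapping cylinder of a diffeomorphism `W ≅ W'` relative to the boundary. -/
noncomputable def isoCylinder (e : W.Comp ≃ W'.Comp) (h : ∀ y, e (W.bd y) = W'.bd y) :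
    Surface W W' where
  K := W'.Comp
  src := e
  tgt := id
  bd := h
  χ := W'.euler

/-- The birth of a circle: the cylinder over `W` together with a disc. -/
noncomputable def birth (W : Curve Y₀ Y₁) : Surface W W.addCircle where
  K := W.addCircle.Comp
  src := W.inclComp
  tgt := id
  bd := by rintro (y | y) <;> rfl
  χ := Finsupp.mapDomain W.inclComp W.euler + Finsupp.single W.circle 1

/-- The death of a circle. -/
noncomputable def death (W : Curve Y₀ Y₁) : Surface W.addCircle W where
  K := W.addCircle.Comp
  src := id
  tgt := W.inclComp
  bd := by rintro (y | y) <;> rfl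
  χ := Finsupp.mapDomain W.inclComp W.euler + Finsupp.single W.circle 1

/-- The disjoint union with a closed connected surface of Euler characteristic `m`. -/
noncomputable def addClosed (S : Surface W W') (m : ℤ) : Surface W W' where
  K := S.K ⊕ Unit
  src c := Sum.inl (S.src c)
  tgt c := Sum.inl (S.tgt c)
  bd y := congrArg Sum.inl (S.bd y)
  χ := Finsupp.mapDomain Sum.inl S.χ + Finsupp.single (Sum.inr ()) m

/-- Remove two discs from the components `p` and `q` and join the holes by a tube. -/
noncomputable def tube (S : Surface W W') (p q : S.K) : Surface W W' where
  K := Quot (fun a b => a = p ∧ b = q)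
  src c := Quot.mk _ (S.src c)
  tgt c := Quot.mk _ (S.tgt c)
  bd y := congrArg _ (S.bd y)
  χ := Finsupp.mapDomain (Quot.mk _) S.χ + Finsupp.single (Quot.mk _ p) (-2)

end Surface

/-- The surface data which come from `2`-bordisms, i.e. from compact oriented surfaces with
corners.  By Morse theory every `2`-bordism is a composite of cylinders, births and deaths of
circles and saddles (a cylinder with a handle, being a composite of two saddles and cylinders, is
included only for convenience). -/
inductive IsBordism : ∀ {W W' : Curve Y₀ Y₁}, (W ⟶ W') → Prop
  | iso {W W' : Curve Y₀ Y₁} (e : W.Comp ≃ W'.Comp) (h : ∀ y, e (W.bd y) = W'.bd y) :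
      IsBordism (Quotient.mk _ (Surface.isoCylinder e h))
  | birth (W : Curve Y₀ Y₁) : IsBordism (Quotient.mk _ (Surface.birth W))
  | death (W : Curve Y₀ Y₁) : IsBordism (Quotient.mk _ (Surface.death W))
  | saddle {E : Type} [Finite E] (n n' : Start Y₀ Y₁ ⊕ E ≃ E ⊕ Stop Y₀ Y₁)
      (x y : Start Y₀ Y₁ ⊕ E) (h : IsSaddle n n' x y) :
      IsBordism (Quotient.mk _ (saddleSurface n n' x y h))
  | handle {E : Type} [Finite E] (n : Start Y₀ Y₁ ⊕ E ≃ E ⊕ Stop Y₀ Y₁) (x : Start Y₀ Y₁ ⊕ E) :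
      IsBordism (Quotient.mk _ (handleSurface n x))
  | comp {W W' W'' : Curve Y₀ Y₁} (f : W ⟶ W') (g : W' ⟶ W'') :
      IsBordism f → IsBordism g → IsBordism (f ≫ g)

/-- `IsBordism` as a property of morphisms. -/
def bordisms (Y₀ Y₁ : Points) : MorphismProperty (Curve Y₀ Y₁) := fun _ _ f => IsBordism f

instance : (bordisms Y₀ Y₁).IsMultiplicative where
  id_mem _ := IsBordism.iso (Equiv.refl _) (fun _ => rfl)
  comp_mem f g hf hg := IsBordism.comp f g hf hg

/-- The category `Cob₂(Y₀, Y₁)`: objects are cobordisms `W : Y₀ → Y₁`, morphisms are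
diffeomorphism classes of `2`-bordisms. -/
abbrev Cob₂ (Y₀ Y₁ : Points) : Type 1 := WideSubcategory (bordisms Y₀ Y₁)

section Linear

universe u

variable (k : Type u) [CommRing k]

/-- A `2`-bordism as a basis element of the free `k`-linear category. -/
noncomputable def basis {X Y : Cob₂ Y₀ Y₁} (f : X ⟶ Y) : Free.of k X ⟶ Free.of k Y :=
  (Free.embedding k (Cob₂ Y₀ Y₁)).map f

/-- The elements which the relations `S`, `T` and `4Tu` set to zero.  In `4Tu` there are four
discs, on the components `p₁, p₂, p₃, p₄` of a surface, and the four terms have one tube each. -/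
inductive LocalRel : ∀ {X Y : Cob₂ Y₀ Y₁}, (Free.of k X ⟶ Free.of k Y) → Prop
  | sphere {X Y : Cob₂ Y₀ Y₁} (S : Surface X.obj Y.obj) (hS : IsBordism (Quotient.mk _ S))
      (f : X ⟶ Y) (hf : f.hom = Quotient.mk _ (S.addClosed 2)) : LocalRel (basis k f)
  | torus {X Y : Cob₂ Y₀ Y₁} (S : Surface X.obj Y.obj) (f g : X ⟶ Y)
      (hf : f.hom = Quotient.mk _ (S.addClosed 0)) (hg : g.hom = Quotient.mk _ S) :
      LocalRel (basis k f - (2 : k) • basis k g)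
  | fourTu {X Y : Cob₂ Y₀ Y₁} (S : Surface X.obj Y.obj) (hS : IsBordism (Quotient.mk _ S))
      (p₁ p₂ p₃ p₄ : S.K) (f₁ f₂ f₃ f₄ : X ⟶ Y)
      (h₁ : f₁.hom = Quotient.mk _ (S.tube p₁ p₂)) (h₂ : f₂.hom = Quotient.mk _ (S.tube p₃ p₄))
      (h₃ : f₃.hom = Quotient.mk _ (S.tube p₁ p₃)) (h₄ : f₄.hom = Quotient.mk _ (S.tube p₂ p₄)) :
      LocalRel (basis k f₁ + basis k f₂ - basis k f₃ - basis k f₄)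

/-- The ideal of the `k`-linear category generated by the local relations. -/
noncomputable def relIdeal (X Y : Free k (Cob₂ Y₀ Y₁)) : Submodule k (X ⟶ Y) :=
  Submodule.span k {h | ∃ (A B : Cob₂ Y₀ Y₁) (a : X ⟶ Free.of k A)
    (r : Free.of k A ⟶ Free.of k B) (b : Free.of k B ⟶ Y), LocalRel k r ∧ h = a ≫ r ≫ b}

/-- Two morphisms are identified if they differ by an element of the ideal. -/
def relHom : HomRel (Free k (Cob₂ Y₀ Y₁)) := fun X Y f g => f - g ∈ relIdeal k X Y

lemma relIdeal_comp_left {X Y Z : Free k (Cob₂ Y₀ Y₁)} (f : X ⟶ Y) {g : Y ⟶ Z}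
    (hg : g ∈ relIdeal k Y Z) : f ≫ g ∈ relIdeal k X Z := by
  induction hg using Submodule.span_induction with
  | mem x hx =>
    obtain ⟨A, B, a, r, b, hr, rfl⟩ := hx
    exact Submodule.subset_span ⟨A, B, f ≫ a, r, b, hr, by simp⟩
  | zero => simp
  | add x y _ _ hx hy => rw [Preadditive.comp_add]; exact add_mem hx hy
  | smul c x _ hx => rw [Linear.comp_smul]; exact Submodule.smul_mem _ _ hx

lemma relIdeal_comp_right {X Y Z : Free k (Cob₂ Y₀ Y₁)} {f : X ⟶ Y} (g : Y ⟶ Z)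
    (hf : f ∈ relIdeal k X Y) : f ≫ g ∈ relIdeal k X Z := by
  induction hf using Submodule.span_induction with
  | mem x hx =>
    obtain ⟨A, B, a, r, b, hr, rfl⟩ := hx
    exact Submodule.subset_span ⟨A, B, a, r, b ≫ g, hr, by simp⟩
  | zero => simp
  | add x y _ _ hx hy => rw [Preadditive.add_comp]; exact add_mem hx hy
  | smul c x _ hx => rw [Linear.smul_comp]; exact Submodule.smul_mem _ _ hx

instance : Congruence (relHom k (Y₀ := Y₀) (Y₁ := Y₁)) where
  equivalence :=
    { refl := fun f => by simp [relHom]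
      symm := fun {f g} h => by
        have := neg_mem h
        rwa [neg_sub] at this
      trans := fun {f g h} h1 h2 => by
        have := add_mem h1 h2
        rwa [sub_add_sub_cancel] at this }
  comp_left f _ _ h := by
    have := relIdeal_comp_left k f h
    rwa [Preadditive.comp_sub] at this
  comp_right g h := by
    have := relIdeal_comp_right k g h
    rwa [Preadditive.sub_comp] at this

/-- The category `k Cob₂(Y₀, Y₁) / (S, T, 4Tu)`. -/
abbrev KCob (Y₀ Y₁ : Points) : Type 1 :=
  CategoryTheory.Quotient (relHom k (Y₀ := Y₀) (Y₁ := Y₁))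

noncomputable instance : Preadditive (KCob k Y₀ Y₁) :=
  CategoryTheory.Quotient.preadditive _ (fun _ _ _ _ _ _ h h' => by
    have := add_mem h h'
    rwa [← add_sub_add_comm] at this)

instance : (CategoryTheory.Quotient.functor (relHom k (Y₀ := Y₀) (Y₁ := Y₁))).Additive :=
  CategoryTheory.Quotient.functor_additive _ _

noncomputable instance : Linear k (KCob k Y₀ Y₁) :=
  CategoryTheory.Quotient.linear k _ (fun c _ _ _ _ h => by
    have := Submodule.smul_mem _ c h
    rwa [smul_sub] at this)

/-- The category `Cob(Y₀, Y₁) = Mat(k Cob₂(Y₀, Y₁) / (S, T, 4Tu))`. -/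
abbrev Cob (Y₀ Y₁ : Points) : Type 1 := Mat_ (KCob k Y₀ Y₁)

/-- The class of a `2`-bordism in the quotient category. -/
noncomputable def cls {X Y : Cob₂ Y₀ Y₁} (f : X ⟶ Y) :
    (CategoryTheory.Quotient.functor (relHom k)).obj (Free.of k X) ⟶
      (CategoryTheory.Quotient.functor (relHom k)).obj (Free.of k Y) :=
  (CategoryTheory.Quotient.functor (relHom k)).map (basis k f)

lemma cls_comp {X Y Z : Cob₂ Y₀ Y₁} (f : X ⟶ Y) (g : Y ⟶ Z) :
    cls k (f ≫ g) = cls k f ≫ cls k g := by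
  unfold cls basis
  erw [Functor.map_comp, Functor.map_comp]
  rfl

end Linear

/-! ### Tangle diagrams -/

/-- The type of the strands at a level of a diagram whose distance from the left is even
(`c = true`) or odd (`c = false`). -/
def At : Bool → List Bool → Type
  | _, [] => Empty
  | true, _ :: l => Option (At false l)
  | false, _ :: l => At true l

instance At.finite : ∀ (c : Bool) (l : List Bool), Finite (At c l)
  | true, [] => inferInstanceAs (Finite Empty)
  | false, [] => inferInstanceAs (Finite Empty)
  | true, _ :: l => by
    have := At.finite false l
    exact inferInstanceAs (Finite (Option (At false l)))
  | false, _ :: l => At.finite true l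

/-- The oriented boundary at a level, for the checkerboard colouring with white (`c = true`) or
black (`c = false`) leftmost region.  The curves obtained by smoothing are oriented as boundary of
the black regions, i.e. with black on their left; they point up (label `+`) at the strands with a
black region on the left. -/
def bdry (c : Bool) (l : List Bool) : Points where
  pos := At (!c) l
  neg := At c l

/-- An elementary layer of an oriented tangle shadow in general position: a cup, a cap or a crossing
of two neighbouring strands, with through strands on both sides.  The lists record the orientations
of the strands from left to right (`true` is upwards). -/
inductive Layer : List Bool → List Bool → Type
  | cup (b : Bool) (l : List Bool) : Layer l (b :: (!b) :: l)
  | cap (b : Bool) (l : List Bool) : Layer (b :: (!b) :: l) l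
  | cross (a b : Bool) (l : List Bool) : Layer (a :: b :: l) (b :: a :: l)
  | strand (a : Bool) {l l' : List Bool} : Layer l l' → Layer (a :: l) (a :: l')

/-- An oriented tangle shadow (a diagram in `ℝ × [0,1]` without crossing information), cut from
bottom to top into elementary layers. -/
inductive Shape (l : List Bool) : List Bool → Type
  | nil : Shape l l
  | snoc {l' l'' : List Bool} : Shape l l' → Layer l' l'' → Shape l l''

/-- The crossings in a layer. -/
def Layer.V : ∀ {l l' : List Bool}, Layer l l' → Type
  | _, _, .cup _ _ => Empty
  | _, _, .cap _ _ => Empty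
  | _, _, .cross _ _ _ => Unit
  | _, _, .strand _ L => L.V

instance Layer.finiteV : ∀ {l l' : List Bool} (L : Layer l l'), Finite L.V
  | _, _, .cup _ _ => inferInstanceAs (Finite Empty)
  | _, _, .cap _ _ => inferInstanceAs (Finite Empty)
  | _, _, .cross _ _ _ => inferInstanceAs (Finite Unit)
  | _, _, .strand _ L => L.finiteV

/-- The vertices of a shadow. -/
def Shape.V {l : List Bool} : ∀ {l' : List Bool}, Shape l l' → Type
  | _, .nil => Empty
  | _, .snoc S L => S.V ⊕ L.V

instance Shape.finiteV {l l' : List Bool} (S : Shape l l') : Finite S.V := by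
  induction S with
  | nil => exact Finite.of_equiv Empty (Equiv.refl _)
  | snoc S L ih => exact Finite.of_equiv (S.V ⊕ L.V) (Equiv.refl _)

noncomputable instance Shape.fintypeV {l l' : List Bool} (S : Shape l l') : Fintype S.V :=
  Fintype.ofFinite _

section Match

variable {A B C D : Type}

/-- Add a through strand running down, to a matching of ends. -/
def addDown (e : A ⊕ B ≃ C ⊕ D) : A ⊕ Option B ≃ Option C ⊕ D where
  toFun
    | .inl a => Sum.map some id (e (.inl a))
    | .inr none => .inl none
    | .inr (some b) => Sum.map some id (e (.inr b))
  invFun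
    | .inl none => .inr none
    | .inl (some c) => Sum.map id some (e.symm (.inl c))
    | .inr d => Sum.map id some (e.symm (.inr d))
  left_inv := by
    rintro (a | _ | b)
    · rcases h : e (.inl a) with c | d <;>
        simp only [h, Sum.map_inl, Sum.map_inr, id] <;> rw [← h, e.symm_apply_apply] <;> rfl
    · rfl
    · rcases h : e (.inr b) with c | d <;>
        simp only [h, Sum.map_inl, Sum.map_inr, id] <;> rw [← h, e.symm_apply_apply] <;> rfl
  right_inv := by
    rintro ((_ | c) | d)
    · rfl
    · rcases h : e.symm (.inl c) with a | b <;>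
        simp only [h, Sum.map_inl, Sum.map_inr, id] <;> rw [← h, e.apply_symm_apply] <;> rfl
    · rcases h : e.symm (.inr d) with a | b <;>
        simp only [h, Sum.map_inl, Sum.map_inr, id] <;> rw [← h, e.apply_symm_apply] <;> rfl

/-- Add a through strand running up, to a matching of ends. -/
def addUp (e : A ⊕ B ≃ C ⊕ D) : Option A ⊕ B ≃ C ⊕ Option D :=
  (Equiv.sumComm _ _).trans ((addDown ((Equiv.sumComm _ _).trans
    (e.trans (Equiv.sumComm _ _)))).trans (Equiv.sumComm _ _))

/-- A cup, with through strands. -/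
def cupMatch : A ⊕ Option B ≃ B ⊕ Option A where
  toFun
    | .inl a => .inr (some a)
    | .inr none => .inr none
    | .inr (some b) => .inl b
  invFun
    | .inl b => .inr (some b)
    | .inr none => .inr none
    | .inr (some a) => .inl a
  left_inv := by rintro (a | _ | b) <;> rfl
  right_inv := by rintro (a | _ | b) <;> rfl

/-- A cap, with through strands. -/
def capMatch : Option A ⊕ B ≃ Option B ⊕ A where
  toFun
    | .inl none => .inl none
    | .inl (some a) => .inr a
    | .inr b => .inl (some b)
  invFun
    | .inl none => .inl none
    | .inl (some b) => .inr b
    | .inr a => .inl (some a)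
  left_inv := by rintro ((_ | a) | b) <;> rfl
  right_inv := by rintro ((_ | a) | b) <;> rfl

/-- A smoothed crossing, with through strands: two vertical strands if `v` is true, otherwise a cap
below a cup. -/
def crossMatch (v : Bool) : Option A ⊕ Option B ≃ Option B ⊕ Option A where
  toFun
    | .inl none => if v then .inr none else .inl none
    | .inr none => if v then .inl none else .inr none
    | .inl (some a) => .inr (some a)
    | .inr (some b) => .inl (some b)
  invFun
    | .inl none => if v then .inr none else .inl none
    | .inr none => if v then .inl none else .inr none
    | .inl (some b) => .inr (some b)
    | .inr (some a) => .inl (some a)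
  left_inv := by rintro ((_ | a) | (_ | b)) <;> cases v <;> rfl
  right_inv := by rintro ((_ | a) | (_ | b)) <;> cases v <;> rfl

end Match

/-- The arcs of a layer, each directed with the black region on its left; a crossing is smoothed
according to the orientation of the tangle, so vertically iff both strands go up or both down. -/
def Layer.flow : ∀ {l l' : List Bool} (c : Bool) (_ : Layer l l'),
    Start (bdry c l) (bdry c l') ≃ Stop (bdry c l) (bdry c l')
  | _, _, true, .cup _ l => cupMatch (A := At false l) (B := At true l)
  | _, _, false, .cup _ l => cupMatch (A := At true l) (B := At false l)
  | _, _, true, .cap _ l => capMatch (A := At false l) (B := At true l)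
  | _, _, false, .cap _ l => capMatch (A := At true l) (B := At false l)
  | _, _, true, .cross a b l => crossMatch (A := At false l) (B := At true l) (a == b)
  | _, _, false, .cross a b l => crossMatch (A := At true l) (B := At false l) (a == b)
  | _, _, true, .strand _ L => addDown (L.flow false)
  | _, _, false, .strand _ L => addUp (L.flow true)

/-- The two tails of the arcs at a crossing which is smoothed according to the orientation of the
tangle: `(v, true)` gives the tail of the arc which is on the left with respect to the orientation
of the tangle, `(v, false)` that of the arc on the right.  (The one tail is at the bottom of the
layer, the other at the top.) -/
def Layer.entry : ∀ {l l' : List Bool} (c : Bool) (L : Layer l l'),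
    L.V × Bool → Start (bdry c l) (bdry c l')
  | _, _, true, .cross a _ l, (_, left) =>
    if left = a then (.inr none : Option (At false l) ⊕ Option (At true l)) else .inl none
  | _, _, false, .cross _ b l, (_, left) =>
    if left = !b then (.inr none : Option (At true l) ⊕ Option (At false l)) else .inl none
  | _, _, true, .strand _ L, x => Sum.map id some (L.entry false x)
  | _, _, false, .strand _ L, x => Sum.map some id (L.entry true x)

lemma Layer.entry_injective : ∀ {l l' : List Bool} (c : Bool) (L : Layer l l'),
    Function.Injective (L.entry c)
  | _, _, true, .cross a _ l => by
    rintro ⟨⟨⟩, x⟩ ⟨⟨⟩, y⟩ h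
    cases x <;> cases y <;> cases a <;> simp_all [Layer.entry]
  | _, _, false, .cross _ b l => by
    rintro ⟨⟨⟩, x⟩ ⟨⟨⟩, y⟩ h
    cases x <;> cases y <;> cases b <;> simp_all [Layer.entry]
  | _, _, true, .cup _ _ => fun x => x.1.elim
  | _, _, false, .cup _ _ => fun x => x.1.elim
  | _, _, true, .cap _ _ => fun x => x.1.elim
  | _, _, false, .cap _ _ => fun x => x.1.elim
  | _, _, true, .strand _ L => fun x y h => L.entry_injective false
      (Function.Injective.sumMap Function.injective_id (Option.some_injective _) h)
  | _, _, false, .strand _ L => fun x y h => L.entry_injective true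
      (Function.Injective.sumMap (Option.some_injective _) Function.injective_id h)

section Regroup

variable {A B C D E : Type}

/-- Regrouping of the tails of edges when two curves are composed. -/
def regroupTail : (A ⊕ D) ⊕ (E ⊕ (B ⊕ C)) ≃ ((A ⊕ C) ⊕ E) ⊕ (B ⊕ D) where
  toFun
    | .inl (.inl a) => .inl (.inl (.inl a))
    | .inl (.inr d) => .inr (.inr d)
    | .inr (.inl e) => .inl (.inr e)
    | .inr (.inr (.inl b)) => .inr (.inl b)
    | .inr (.inr (.inr c)) => .inl (.inl (.inr c))
  invFun
    | .inl (.inl (.inl a)) => .inl (.inl a)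
    | .inr (.inr d) => .inl (.inr d)
    | .inl (.inr e) => .inr (.inl e)
    | .inr (.inl b) => .inr (.inr (.inl b))
    | .inl (.inl (.inr c)) => .inr (.inr (.inr c))
  left_inv := by rintro ((a | d) | (e | (b | c))) <;> rfl
  right_inv := by rintro (((a | c) | e) | (b | d)) <;> rfl

/-- Regrouping of the heads of edges when two curves are composed. -/
def regroupHead : (E ⊕ (A ⊕ B)) ⊕ (C ⊕ D) ≃ (E ⊕ (B ⊕ C)) ⊕ (A ⊕ D) where
  toFun
    | .inl (.inl e) => .inl (.inl e)
    | .inl (.inr (.inl a)) => .inr (.inl a)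
    | .inl (.inr (.inr b)) => .inl (.inr (.inl b))
    | .inr (.inl c) => .inl (.inr (.inr c))
    | .inr (.inr d) => .inr (.inr d)
  invFun
    | .inl (.inl e) => .inl (.inl e)
    | .inr (.inl a) => .inl (.inr (.inl a))
    | .inl (.inr (.inl b)) => .inl (.inr (.inr b))
    | .inl (.inr (.inr c)) => .inr (.inl c)
    | .inr (.inr d) => .inr (.inr d)
  left_inv := by rintro ((e | (a | b)) | (c | d)) <;> rfl
  right_inv := by rintro ((e | (b | c)) | (a | d)) <;> rfl

end Regroup

/-- What is needed of a coloured tangle shadow with set of vertices `V`: the curve obtained by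
smoothing each vertex according to the orientation of the tangle (directed with the black regions
on its left), and the two tails at each vertex, `(v, true)` belonging to the strand on the left and
`(v, false)` to the strand on the right with respect to the orientation of the tangle.  Exchanging
the edges which leave these two points gives the other smoothing of `v`. -/
structure Shadow (V : Type) (Y₀ Y₁ : Points) where
  E : Type
  [fin : Finite E]
  flow : Start Y₀ Y₁ ⊕ E ≃ E ⊕ Stop Y₀ Y₁
  entry : V × Bool ↪ Start Y₀ Y₁ ⊕ E

attribute [instance] Shadow.fin

/-- The shadow of parallel vertical strands. -/
def Shadow.parallel (Y : Points) : Shadow Empty Y Y where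
  E := Empty
  flow := (Equiv.sumEmpty _ _).trans ((Equiv.sumComm _ _).trans (Equiv.emptySum _ _).symm)
  entry := ⟨fun x => x.1.elim, fun x => x.1.elim⟩

/-- Put a layer on top of a shadow; the strands at the level in between become interior points. -/
def Shadow.addLayer {V : Type} {c : Bool} {l l' l'' : List Bool}
    (S : Shadow V (bdry c l) (bdry c l')) (L : Layer l' l'') :
    Shadow (V ⊕ L.V) (bdry c l) (bdry c l'') where
  E := S.E ⊕ ((bdry c l').pos ⊕ (bdry c l').neg)
  flow := regroupTail.trans ((Equiv.sumCongr S.flow (L.flow c)).trans regroupHead)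
  entry :=
    { toFun := fun x => regroupTail.symm (match x with
        | (.inl v, b) => .inl (S.entry (v, b))
        | (.inr w, b) => .inr (L.entry c (w, b)))
      inj' := by
        rintro ⟨v | v, b⟩ ⟨w | w, b'⟩ h
        · have := S.entry.injective (Sum.inl_injective (regroupTail.symm.injective h))
          simp_all
        · cases regroupTail.symm.injective h
        · cases regroupTail.symm.injective h
        · have := L.entry_injective c (Sum.inr_injective (regroupTail.symm.injective h))
          simp_all }

/-- The shadow of a diagram with a checkerboard colouring. -/
def Shape.shadow (c : Bool) {l : List Bool} :
    ∀ {l' : List Bool} (S : Shape l l'), Shadow S.V (bdry c l) (bdry c l')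
  | _, .nil => Shadow.parallel _
  | _, .snoc S L => (S.shadow c).addLayer L

/-! ### Composition of built surfaces -/

section BuiltComp

variable {E : Type} {n n' n'' : Start Y₀ Y₁ ⊕ E ≃ E ⊕ Stop Y₀ Y₁}
  {T T' : Pt Y₀ Y₁ E → Pt Y₀ Y₁ E → Prop}

/-- The union of two relations. -/
def orRel (T T' : Pt Y₀ Y₁ E → Pt Y₀ Y₁ E → Prop) (p q : Pt Y₀ Y₁ E) : Prop := T p q ∨ T' p q

lemma join_le (h : Compat n n' T) {p q : Pt Y₀ Y₁ E} (hpq : Join n' T' p q) :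
    Relation.EqvGen (Join n (orRel T T')) p q := by
  rcases hpq with ⟨z, rfl, rfl⟩ | hT
  · exact (h z).mono (fun a b hab => hab.imp id Or.inl)
  · exact .rel _ _ (Or.inr (Or.inr hT))

lemma compat_trans (h : Compat n n' T) (h' : Compat n' n'' T') : Compat n n'' (orRel T T') := by
  intro z
  have key : ∀ p q, Relation.EqvGen (Join n' T') p q →
      Relation.EqvGen (Join n (orRel T T')) p q := by
    intro p q hpq
    induction hpq with
    | rel _ _ hr => exact join_le h hr
    | refl _ => exact .refl _
    | symm _ _ _ ih => exact ih.symm _ _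
    | trans _ _ _ _ _ i1 i2 => exact i1.trans _ _ _ i2
  exact key _ _ (h' z)

lemma built_glue [Finite E] (h : Compat n n' T) (h' : Compat n' n'' T') (a a' : Pt Y₀ Y₁ E →₀ ℤ) :
    Surface.Rel ((built n n' T h a).glue (built n' n'' T' h' a'))
      (built n n'' (orRel T T') (compat_trans h h') (a + a')) := by
  refine ⟨⟨Quot.lift (Sum.elim (Quot.map id fun _ _ hs => hs.imp id Or.inl)
      (Quot.lift (Quot.mk _) fun p q hs => Quot.eqvGen_sound (join_le h hs))) ?_,
    Quot.lift (fun p => Quot.mk _ (Sum.inl (Quot.mk _ p))) ?_, ?_, ?_⟩, ?_, ?_, ?_⟩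
  · rintro _ _ ⟨⟨c⟩, rfl, rfl⟩; rfl
  · intro p q hpq
    have glue : ∀ p, (Quot.mk _ (Sum.inl (Quot.mk _ p)) :
        ((built n n' T h a).glue (built n' n'' T' h' a')).K) =
          Quot.mk _ (Sum.inr (Quot.mk _ p)) :=
      fun p => Quot.sound ⟨Quot.mk _ p, rfl, rfl⟩
    rcases hpq with hs | hT | hT
    · exact congrArg (fun t => Quot.mk _ (Sum.inl t)) (Quot.sound (Or.inl hs))
    · exact congrArg (fun t => Quot.mk _ (Sum.inl t)) (Quot.sound (Or.inr hT))
    · rw [glue p, glue q]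
      exact congrArg (fun t => Quot.mk _ (Sum.inr t)) (Quot.sound (Or.inr hT))
  · rintro ⟨⟨⟨p⟩⟩ | ⟨⟨p⟩⟩⟩
    · rfl
    · exact Quot.sound ⟨Quot.mk _ p, rfl, rfl⟩
  · rintro ⟨p⟩; rfl
  · rintro ⟨p⟩; rfl
  · rintro ⟨p⟩; rfl
  · simp only [Surface.glue, built, Curve.euler, Surface.mapDomain_sub, Finsupp.mapDomain_add,
      ← Finsupp.mapDomain_comp]
    have key : ∀ (s u v : Quot (Join n (orRel T T')) →₀ ℤ),
        s + u + (s + v) - s = s + (u + v) := by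
      intro s u v; abel
    exact key _ _ _

end BuiltComp

/-! ### Elementary morphisms between the smoothings of a shadow -/

namespace Shadow

variable {V : Type} (S : Shadow V Y₀ Y₁)

/-- The permutation of the tails prescribed by the choice `f` of smoothings. -/
def flip (f : V → Bool) : Equiv.Perm (V × Bool) where
  toFun p := (p.1, if f p.1 then p.2 else !p.2)
  invFun p := (p.1, if f p.1 then p.2 else !p.2)
  left_inv := by rintro ⟨v, b⟩; cases h : f v <;> simp [h]
  right_inv := by rintro ⟨v, b⟩; cases h : f v <;> simp [h]

/-- The edges of the smoothing in which the vertex `v` is smoothed according to the orientation of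
the tangle if `f v` is true, and in the other way if it is false. -/
noncomputable def next (f : V → Bool) : Start Y₀ Y₁ ⊕ S.E ≃ S.E ⊕ Stop Y₀ Y₁ :=
  ((flip f).viaEmbedding S.entry).trans S.flow

lemma next_entry (f : V → Bool) (v : V) (b : Bool) :
    S.next f (S.entry (v, b)) = S.flow (S.entry (v, if f v then b else !b)) := by
  simp [next, Equiv.Perm.viaEmbedding_apply, flip]

lemma next_of_notMem (f : V → Bool) {z : Start Y₀ Y₁ ⊕ S.E} (hz : z ∉ Set.range S.entry) :
    S.next f z = S.flow z := by
  simp [next, Equiv.Perm.viaEmbedding_apply_of_notMem _ _ _ hz]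

/-- The choices `f` and `f'` of smoothings differ exactly at `v`. -/
def Toggle (f f' : V → Bool) (v : V) : Prop := f' v = !(f v) ∧ ∀ w, w ≠ v → f' w = f w

lemma isSaddle {f f' : V → Bool} {v : V} (h : Toggle f f' v) :
    IsSaddle (S.next f) (S.next f') (S.entry (v, true)) (S.entry (v, false)) := by
  refine ⟨fun e => by simpa using S.entry.injective e, ?_, ?_, ?_⟩
  · rw [next_entry, next_entry, h.1]; cases f v <;> rfl
  · rw [next_entry, next_entry, h.1]; cases f v <;> rfl
  · intro z h1 h2
    by_cases hz : z ∈ Set.range S.entry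
    · obtain ⟨⟨w, b⟩, rfl⟩ := hz
      have hw : w ≠ v := by
        rintro rfl
        cases b
        · exact h2 rfl
        · exact h1 rfl
      rw [next_entry, next_entry, h.2 w hw]
    · rw [next_of_notMem _ _ hz, next_of_notMem _ _ hz]

/-- The smoothing of the shadow given by `f`, as an object of the bordism category. -/
noncomputable def smooth (f : V → Bool) : Cob₂ Y₀ Y₁ := ⟨⟨S.E, S.next f⟩⟩

/-- The saddle at `v`. -/
noncomputable def saddle {f f' : V → Bool} {v : V} (h : Toggle f f' v) :
    S.smooth f ⟶ S.smooth f' :=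
  ⟨Quotient.mk _ (saddleSurface _ _ _ _ (S.isSaddle h)), IsBordism.saddle _ _ _ _ _⟩

lemma toggle_update [DecidableEq V] (f : V → Bool) (v : V) :
    Toggle f (Function.update f v (!(f v))) v :=
  ⟨by simp, fun w hw => by simp [hw]⟩

lemma Toggle.symm {f f' : V → Bool} {v : V} (h : Toggle f f' v) : Toggle f' f v :=
  ⟨by rw [h.1, Bool.not_not], fun w hw => (h.2 w hw).symm⟩

lemma toggle_back [DecidableEq V] {f f' : V → Bool} (h : f = f') (v : V) :
    Toggle (Function.update f v (!(f v))) f' v :=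
  h ▸ (toggle_update f v).symm

/-- The cylinder over a smoothing with a tube between the two strands at `v`, i.e. the composite of
two saddles. -/
noncomputable def tube [DecidableEq V] {f f' : V → Bool} (h : f = f') (v : V) :
    S.smooth f ⟶ S.smooth f' :=
  S.saddle (toggle_update f v) ≫ S.saddle (toggle_back h v)

lemma compat_eq {f f' : V → Bool} (h : f = f') :
    Compat (S.next f) (S.next f') (fun _ _ => False) :=
  h ▸ compat_self _

/-- The cylinder over a smoothing with a handle on the left strand at `v`. -/
noncomputable def handle {f f' : V → Bool} (h : f = f') (v : V) :
    S.smooth f ⟶ S.smooth f' :=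
  ⟨Quotient.mk _ (built (S.next f) (S.next f') (fun _ _ => False) (S.compat_eq h)
    (Finsupp.single (Sum.inl (S.entry (v, true))) (-2))), by
      subst h; exact IsBordism.handle _ _⟩

/-- `g` is the class of a surface built from the smoothing `f`. -/
def IsBuilt {f f' : V → Bool} (g : S.smooth f ⟶ S.smooth f')
    (T : Pt Y₀ Y₁ S.E → Pt Y₀ Y₁ S.E → Prop) (a : Pt Y₀ Y₁ S.E →₀ ℤ) : Prop :=
  ∃ h : Compat (S.next f) (S.next f') T, g.hom = Quotient.mk _ (built _ _ T h a)

variable {S}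

lemma IsBuilt.comp {f f' f'' : V → Bool} {g : S.smooth f ⟶ S.smooth f'}
    {g' : S.smooth f' ⟶ S.smooth f''} {T T' a a'} (h : S.IsBuilt g T a) (h' : S.IsBuilt g' T' a') :
    S.IsBuilt (g ≫ g') (orRel T T') (a + a') := by
  obtain ⟨c, h⟩ := h
  obtain ⟨c', h'⟩ := h'
  refine ⟨compat_trans c c', ?_⟩
  rw [WideSubcategory.comp_def, h, h']
  exact Quotient.sound (built_glue c c' a a')

lemma IsBuilt.eq {f f' : V → Bool} {g g' : S.smooth f ⟶ S.smooth f'} {T T' a a'}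
    (h : S.IsBuilt g T a) (h' : S.IsBuilt g' T' a') (hT : ∀ p q, T p q ↔ T' p q) (ha : a = a') :
    g = g' := by
  obtain rfl : T = T' := by funext p q; exact propext (hT p q)
  subst ha
  obtain ⟨c, h⟩ := h
  obtain ⟨c', h'⟩ := h'
  apply WideSubcategory.hom_ext
  rw [h, h']

lemma saddle_isBuilt {f f' : V → Bool} {v : V} (h : Toggle f f' v) :
    S.IsBuilt (S.saddle h) (JoinTwo (S.entry (v, true)) (S.entry (v, false)))
      (Finsupp.single (Sum.inl (S.entry (v, true))) (-1)) :=
  ⟨_, rfl⟩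

lemma tube_isBuilt [DecidableEq V] {f f' : V → Bool} (h : f = f') (v : V) :
    S.IsBuilt (S.tube h v) (JoinTwo (S.entry (v, true)) (S.entry (v, false)))
      (Finsupp.single (Sum.inl (S.entry (v, true))) (-2)) := by
  have := (saddle_isBuilt (S := S) (toggle_update f v)).comp
    (saddle_isBuilt (S := S) (toggle_back h v))
  have hT : orRel (JoinTwo (S.entry (v, true)) (S.entry (v, false)))
      (JoinTwo (S.entry (v, true)) (S.entry (v, false))) =
        JoinTwo (S.entry (v, true)) (S.entry (v, false)) := by
    funext p q; simp [orRel]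
  rw [hT, ← Finsupp.single_add] at this
  exact this

lemma handle_isBuilt {f f' : V → Bool} (h : f = f') (v : V) :
    S.IsBuilt (S.handle h v) (fun _ _ => False)
      (Finsupp.single (Sum.inl (S.entry (v, true))) (-2)) :=
  ⟨_, rfl⟩

end Shadow


/-! ### The bracket complex -/

namespace Shadow

universe u

variable (k : Type u) [CommRing k] {V : Type} (S : Shadow V Y₀ Y₁)

/-- The smoothing of the shadow given by `f`, as an object of the quotient category. -/
noncomputable abbrev ob (f : V → Bool) : KCob k Y₀ Y₁ :=
  (CategoryTheory.Quotient.functor (relHom k)).obj (Free.of k (S.smooth f))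

/-- The class of the saddle at `v`. -/
noncomputable def sad {f f' : V → Bool} {v : V} (h : Toggle f f' v) : S.ob k f ⟶ S.ob k f' :=
  cls k (S.saddle h)

/-- The genus-one morphism `Φ` at a vertex `v` which is smoothed according to the orientation: the
two strands joined by a tube, minus the left strand with a handle. -/
noncomputable def genusOne [DecidableEq V] {f f' : V → Bool} (h : f = f') (v : V) :
    S.ob k f ⟶ S.ob k f' :=
  cls k (S.tube h v) - cls k (S.handle h v)

variable {S}

lemma cls_comp_eq {f g g' h : V → Bool} {a : S.smooth f ⟶ S.smooth g} {b : S.smooth g ⟶ S.smooth h}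
    {a' : S.smooth f ⟶ S.smooth g'} {b' : S.smooth g' ⟶ S.smooth h} {T₁ T₂ T₁' T₂' w₁ w₂ w₁' w₂'}
    (h₁ : S.IsBuilt a T₁ w₁) (h₂ : S.IsBuilt b T₂ w₂) (h₁' : S.IsBuilt a' T₁' w₁')
    (h₂' : S.IsBuilt b' T₂' w₂') (hT : ∀ p q, (T₁ p q ∨ T₂ p q) ↔ (T₁' p q ∨ T₂' p q))
    (hw : w₁ + w₂ = w₁' + w₂') : cls k a ≫ cls k b = cls k a' ≫ cls k b' := by
  rw [← cls_comp, ← cls_comp]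
  exact congrArg _ ((h₁.comp h₂).eq (h₁'.comp h₂') hT hw)

lemma sad_sad {f g g' h : V → Bool} {v w : V} (h₁ : Toggle f g v) (h₂ : Toggle g h w)
    (h₁' : Toggle f g' w) (h₂' : Toggle g' h v) :
    S.sad k h₁ ≫ S.sad k h₂ = S.sad k h₁' ≫ S.sad k h₂' :=
  cls_comp_eq k (saddle_isBuilt _) (saddle_isBuilt _) (saddle_isBuilt _) (saddle_isBuilt _)
    (fun _ _ => or_comm) (add_comm _ _)

variable [DecidableEq V]

lemma sad_genusOne {f g g' h : V → Bool} {v w : V} (h₁ : Toggle f g v) (h₂ : g = h)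
    (h₁' : f = g') (h₂' : Toggle g' h v) :
    S.sad k h₁ ≫ S.genusOne k h₂ w = S.genusOne k h₁' w ≫ S.sad k h₂' := by
  unfold sad genusOne
  rw [Preadditive.comp_sub, Preadditive.sub_comp]
  congr 1
  · exact cls_comp_eq k (saddle_isBuilt _) (tube_isBuilt _ _) (tube_isBuilt _ _) (saddle_isBuilt _)
      (fun _ _ => or_comm) (add_comm _ _)
  · exact cls_comp_eq k (saddle_isBuilt _) (handle_isBuilt _ _) (handle_isBuilt _ _)
      (saddle_isBuilt _) (fun _ _ => or_comm) (add_comm _ _)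

lemma genusOne_genusOne {f g g' h : V → Bool} {v w : V} (h₁ : f = g) (h₂ : g = h)
    (h₁' : f = g') (h₂' : g' = h) :
    S.genusOne k h₁ v ≫ S.genusOne k h₂ w = S.genusOne k h₁' w ≫ S.genusOne k h₂' v := by
  unfold genusOne
  simp only [Preadditive.comp_sub, Preadditive.sub_comp]
  rw [cls_comp_eq k (tube_isBuilt (S := S) h₁ v) (tube_isBuilt h₂ w) (tube_isBuilt h₁' w)
      (tube_isBuilt h₂' v) (fun _ _ => or_comm) (add_comm _ _),
    cls_comp_eq k (handle_isBuilt (S := S) h₁ v) (tube_isBuilt h₂ w) (tube_isBuilt h₁' w)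
      (handle_isBuilt h₂' v) (fun _ _ => or_comm) (add_comm _ _),
    cls_comp_eq k (tube_isBuilt (S := S) h₁ v) (handle_isBuilt h₂ w) (handle_isBuilt h₁' w)
      (tube_isBuilt h₂' v) (fun _ _ => or_comm) (add_comm _ _),
    cls_comp_eq k (handle_isBuilt (S := S) h₁ v) (handle_isBuilt h₂ w) (handle_isBuilt h₁' w)
      (handle_isBuilt h₂' v) (fun _ _ => or_comm) (add_comm _ _)]
  abel

lemma sad_genusOne_self {f g h : V → Bool} {v : V} (h₁ : Toggle f g v) (h₂ : g = h) :
    S.sad k h₁ ≫ S.genusOne k h₂ v = 0 := by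
  unfold sad genusOne
  rw [Preadditive.comp_sub, sub_eq_zero]
  exact cls_comp_eq k (saddle_isBuilt _) (tube_isBuilt _ _) (saddle_isBuilt _) (handle_isBuilt _ _)
    (fun _ _ => by simp) rfl

lemma genusOne_sad_self {f g h : V → Bool} {v : V} (h₁ : f = g) (h₂ : Toggle g h v) :
    S.genusOne k h₁ v ≫ S.sad k h₂ = 0 := by
  unfold sad genusOne
  rw [Preadditive.sub_comp, sub_eq_zero]
  exact cls_comp_eq k (tube_isBuilt _ _) (saddle_isBuilt _) (handle_isBuilt _ _) (saddle_isBuilt _)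
    (fun _ _ => by simp) rfl

end Shadow

/-- The kinds of vertices of an oriented singular tangle diagram. -/
inductive Label : Type
  | neg
  | pos
  | double

section Signs

variable {V : Type} [LinearOrder V]

/-- `(-1)^μ` with `μ` the number of elements of `s` which are smaller than `v`; it is the sign both
of `∧ v : E_s → E_{s ∪ v}` (if `v ∉ s`) and of the contraction `E_s → E_{s \ v}` (if `v ∈ s`). -/
def sgn (v : V) (s : Finset V) : ℤ := (-1) ^ (s.filter (· < v)).card

lemma sgn_insert {v w : V} {s : Finset V} (hv : v ∉ s) :
    sgn w (insert v s) = (if v < w then -1 else 1) * sgn w s := by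
  unfold sgn
  rw [Finset.filter_insert]
  split_ifs with h
  · rw [Finset.card_insert_of_notMem (by simp [hv]), pow_succ]; ring
  · simp

lemma sgn_erase {v w : V} {s : Finset V} (hv : v ∈ s) :
    sgn w (s.erase v) = (if v < w then -1 else 1) * sgn w s := by
  have h := sgn_insert (w := w) (Finset.notMem_erase v s)
  rw [Finset.insert_erase hv] at h
  rw [h]
  split_ifs <;> ring

lemma ite_sign {v w : V} (h : v ≠ w) :
    (if v < w then -1 else 1 : ℤ) = - (if w < v then -1 else 1) := by
  rcases lt_or_gt_of_ne h with h | h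
  · simp [h, not_lt_of_gt h]
  · simp [h, not_lt_of_gt h]

end Signs

namespace Shadow

universe u

variable (k : Type u) [CommRing k] {V : Type} (S : Shadow V Y₀ Y₁) (lab : V → Label)

/-- The pairs `(𝔯, s)` consisting of a set `𝔯` of double points (a resolution scheme if all its
elements are double points) and a state `s`, i.e. a set of crossings of the resolved diagram. -/
abbrev Idx (V : Type) : Type := Finset V × Finset V

variable {lab} in
/-- The crossing `v` of the diagram resolved according to `𝔯` is positive. -/
def IsPos (lab : V → Label) (r : Finset V) (v : V) : Prop :=
  lab v = .pos ∨ (lab v = .double ∧ v ∈ r)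

open scoped Classical in
/-- The smoothing `(D_𝔯)_s`.  The `1`-smoothing (`v ∈ s`) of a negative crossing and the
`0`-smoothing (`v ∉ s`) of a positive crossing respect the orientation of the tangle, and the other
ones do not. -/
noncomputable def choice (p : Idx V) (v : V) : Bool := decide (¬ (v ∈ p.2 ↔ IsPos lab p.1 v))

variable [LinearOrder V]

/-- From `p` to `q` the crossing `v` is changed from its `0`- to its `1`-smoothing. -/
def SadTo (v : V) (p q : Idx V) : Prop := v ∉ p.2 ∧ q = (p.1, insert v p.2)

/-- From `p` to `q` the double point `b`, resolved negatively and with its `1`-smoothing, is changed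
to be resolved positively, with its `0`-smoothing. -/
def PhiTo (b : V) (p q : Idx V) : Prop :=
  lab b = .double ∧ b ∉ p.1 ∧ b ∈ p.2 ∧ q = (insert b p.1, p.2.erase b)

variable {lab} in
lemma SadTo.toggle {v : V} {p q : Idx V} (h : SadTo v p q) :
    Toggle (choice lab p) (choice lab q) v := by
  obtain ⟨hv, rfl⟩ := h
  refine ⟨?_, fun w hw => ?_⟩
  · simp only [choice, Finset.mem_insert_self, hv, true_iff, false_iff]
    by_cases hp : IsPos lab p.1 v <;> simp [hp, hv]
  · simp [choice, hw]

variable {lab} in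
lemma PhiTo.eq {b : V} {p q : Idx V} (h : PhiTo lab b p q) : choice lab p = choice lab q := by
  obtain ⟨hb, hr, hs, rfl⟩ := h
  funext w
  unfold choice
  rw [decide_eq_decide]
  by_cases hw : w = b
  · subst hw
    simp [IsPos, hb, hr, hs]
  · simp [IsPos, hw]

/-- The change `SadTo` (`kind = true`) or `PhiTo` (`kind = false`) at `v`. -/
def To : Bool → V → Idx V → Idx V → Prop
  | true => SadTo
  | false => PhiTo lab

open scoped Classical in
/-- The summand of the differential at `v`, from the summand `p` to the summand `q`: for
`kind = true` the signed saddle, for `kind = false` the signed genus-one morphism. -/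
noncomputable def term : ∀ (_ : Bool) (v : V) (p q : Idx V),
    S.ob k (choice lab p) ⟶ S.ob k (choice lab q)
  | true, v, p, q => if h : SadTo v p q then sgn v p.2 • S.sad k (h.toggle (lab := lab)) else 0
  | false, v, p, q => if h : PhiTo lab v p q then sgn v p.2 • S.genusOne k h.eq v else 0

variable {S lab k} in
lemma term_eq_zero {κ : Bool} {v : V} {p q : Idx V} (h : ¬ To lab κ v p q) :
    S.term k lab κ v p q = 0 := by
  cases κ
  · exact dif_neg h
  · exact dif_neg h

variable {S lab k} in
lemma term_sad {v : V} {p q : Idx V} (h : To lab true v p q) :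
    S.term k lab true v p q = sgn v p.2 • S.sad k (SadTo.toggle (lab := lab) h) :=
  dif_pos (show SadTo v p q from h)

variable {S lab k} in
lemma term_phi {v : V} {p q : Idx V} (h : To lab false v p q) :
    S.term k lab false v p q = sgn v p.2 • S.genusOne k (PhiTo.eq h) v :=
  dif_pos (show PhiTo lab v p q from h)

/-- The target of a change. -/
def tgt : Bool → V → Idx V → Idx V
  | true, v, p => (p.1, insert v p.2)
  | false, v, p => (insert v p.1, p.2.erase v)

variable {lab} in
lemma To.eq_tgt {κ : Bool} {v : V} {p q : Idx V} (h : To lab κ v p q) : q = tgt κ v p := by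
  cases κ
  · exact h.2.2.2
  · exact h.2

variable {lab} in
lemma To.swap {κ κ' : Bool} {v w : V} (hvw : v ≠ w) {p q r : Idx V} (h : To lab κ v p q)
    (h' : To lab κ' w q r) : To lab κ' w p (tgt κ' w p) ∧ To lab κ v (tgt κ' w p) r := by
  have hwv := hvw.symm
  cases κ <;> cases κ'
  · obtain ⟨h1, h2, h3, rfl⟩ := h
    obtain ⟨g1, g2, g3, rfl⟩ := h'
    refine ⟨⟨g1, by simp_all, by simp_all, rfl⟩, ⟨h1, by simp_all [tgt], by simp_all [tgt], ?_⟩⟩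
    simp only [tgt]
    rw [Finset.insert_comm, Finset.erase_right_comm]
  · obtain ⟨h1, h2, h3, rfl⟩ := h
    obtain ⟨g3, rfl⟩ := h'
    refine ⟨⟨by simp_all, rfl⟩, ⟨h1, by simp_all [tgt], by simp_all [tgt], ?_⟩⟩
    simp only [tgt]
    rw [Finset.erase_insert_of_ne hwv]
  · obtain ⟨h3, rfl⟩ := h
    obtain ⟨g1, g2, g3, rfl⟩ := h'
    refine ⟨⟨g1, by simp_all, by simp_all, rfl⟩, ⟨by simp_all [tgt], ?_⟩⟩
    simp only [tgt]
    rw [Finset.erase_insert_of_ne hvw]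
  · obtain ⟨h3, rfl⟩ := h
    obtain ⟨g3, rfl⟩ := h'
    refine ⟨⟨by simp_all, rfl⟩, ⟨by simp_all [tgt], ?_⟩⟩
    simp only [tgt]
    rw [Finset.insert_comm]

lemma term_comp {κ κ' : Bool} {v w : V} (hvw : v ≠ w) {p q q' r : Idx V} (h₁ : To lab κ v p q)
    (h₂ : To lab κ' w q r) (h₁' : To lab κ' w p q') (h₂' : To lab κ v q' r) :
    S.term k lab κ v p q ≫ S.term k lab κ' w q r +
      S.term k lab κ' w p q' ≫ S.term k lab κ v q' r = 0 := by
  have hs := ite_sign hvw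
  have hsq : (if w < v then -1 else 1 : ℤ) * (if w < v then -1 else 1 : ℤ) = 1 := by
    split_ifs <;> rfl
  have fin : ∀ {X Y : KCob k Y₀ Y₁} (A B : X ⟶ Y) (a b : ℤ), A = B → a = -b →
      a • A + b • B = 0 := by
    intro X Y A B a b hAB hab
    rw [hAB, hab, neg_smul, neg_add_cancel]
  have sg : ∀ (a b a' b' : ℤ), a' = (if v < w then -1 else 1 : ℤ) * a →
      b' = (if w < v then -1 else 1 : ℤ) * b → a' * b = - (b' * a) := by
    intro a b a' b' h h'
    rw [h, h', hs]; ring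
  cases κ <;> cases κ'
  · have e : q.2 = p.2.erase v := by rw [h₁.2.2.2]
    have e' : q'.2 = p.2.erase w := by rw [h₁'.2.2.2]
    rw [term_phi h₁, term_phi h₂, term_phi h₁', term_phi h₂']
    simp only [Preadditive.zsmul_comp, Preadditive.comp_zsmul, smul_smul]
    refine fin _ _ _ _ (genusOne_genusOne k _ _ _ _) (sg _ _ _ _ ?_ ?_)
    · rw [e]; exact sgn_erase h₁.2.2.1
    · rw [e']; exact sgn_erase h₁'.2.2.1
  · have e : q.2 = p.2.erase v := by rw [h₁.2.2.2]
    have e' : q'.2 = insert w p.2 := by rw [h₁'.2]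
    rw [term_phi h₁, term_sad h₂, term_sad h₁', term_phi h₂']
    simp only [Preadditive.zsmul_comp, Preadditive.comp_zsmul, smul_smul]
    refine fin _ _ _ _ (sad_genusOne k _ _ _ _).symm (sg _ _ _ _ ?_ ?_)
    · rw [e]; exact sgn_erase h₁.2.2.1
    · rw [e']; exact sgn_insert h₁'.1
  · have e : q.2 = insert v p.2 := by rw [h₁.2]
    have e' : q'.2 = p.2.erase w := by rw [h₁'.2.2.2]
    rw [term_sad h₁, term_phi h₂, term_phi h₁', term_sad h₂']
    simp only [Preadditive.zsmul_comp, Preadditive.comp_zsmul, smul_smul]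
    refine fin _ _ _ _ (sad_genusOne k _ _ _ _) (sg _ _ _ _ ?_ ?_)
    · rw [e]; exact sgn_insert h₁.1
    · rw [e']; exact sgn_erase h₁'.2.2.1
  · have e : q.2 = insert v p.2 := by rw [h₁.2]
    have e' : q'.2 = insert w p.2 := by rw [h₁'.2]
    rw [term_sad h₁, term_sad h₂, term_sad h₁', term_sad h₂']
    simp only [Preadditive.zsmul_comp, Preadditive.comp_zsmul, smul_smul]
    refine fin _ _ _ _ (sad_sad k _ _ _ _) (sg _ _ _ _ ?_ ?_)
    · rw [e]; exact sgn_insert h₁.1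
    · rw [e']; exact sgn_insert h₁'.1

lemma term_comp_self (κ κ' : Bool) (v : V) (p q r : Idx V) :
    S.term k lab κ v p q ≫ S.term k lab κ' v q r = 0 := by
  by_cases h₁ : To lab κ v p q
  swap
  · rw [term_eq_zero h₁, Limits.zero_comp]
  by_cases h₂ : To lab κ' v q r
  swap
  · rw [term_eq_zero h₂, Limits.comp_zero]
  cases κ <;> cases κ'
  · obtain ⟨_, _, _, rfl⟩ := h₁
    exact absurd h₂.2.2.1 (by simp)
  · rw [term_phi h₁, term_sad h₂]
    simp only [Preadditive.zsmul_comp, Preadditive.comp_zsmul, genusOne_sad_self, smul_zero]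
  · rw [term_sad h₁, term_phi h₂]
    simp only [Preadditive.zsmul_comp, Preadditive.comp_zsmul, sad_genusOne_self, smul_zero]
  · obtain ⟨_, rfl⟩ := h₁
    exact absurd (Finset.mem_insert_self _ _) h₂.1

variable [Fintype V]

lemma sum_term_comp (κ κ' : Bool) (v w : V) (p r : Idx V) :
    (∑ q, S.term k lab κ v p q ≫ S.term k lab κ' w q r) +
      ∑ q, S.term k lab κ' w p q ≫ S.term k lab κ v q r = 0 := by
  by_cases hvw : v = w
  · subst hvw
    simp [term_comp_self]
  rw [Finset.sum_eq_single (tgt κ v p), Finset.sum_eq_single (tgt κ' w p)]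
  · by_cases h : To lab κ v p (tgt κ v p) ∧ To lab κ' w (tgt κ v p) r
    · obtain ⟨h3, h4⟩ := h.1.swap hvw h.2
      exact S.term_comp k lab hvw h.1 h.2 h3 h4
    · by_cases h' : To lab κ' w p (tgt κ' w p) ∧ To lab κ v (tgt κ' w p) r
      · exact absurd (h'.1.swap (Ne.symm hvw) h'.2) h
      · rw [not_and_or] at h h'
        have z : ∀ {κ κ' : Bool} {v w : V} {q : Idx V},
            (¬ To lab κ v p q ∨ ¬ To lab κ' w q r) →
              S.term k lab κ v p q ≫ S.term k lab κ' w q r = 0 := by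
          rintro κ κ' v w q (h | h)
          · rw [term_eq_zero h, Limits.zero_comp]
          · rw [term_eq_zero h, Limits.comp_zero]
        rw [z h, z h', add_zero]
  · intro q _ hq
    rw [term_eq_zero (fun h => hq h.eq_tgt), Limits.zero_comp]
  · simp
  · intro q _ hq
    rw [term_eq_zero (fun h => hq h.eq_tgt), Limits.zero_comp]
  · simp

/-- The component of the differential from the summand `p` to the summand `q`. -/
noncomputable def diff (p q : Idx V) : S.ob k (choice lab p) ⟶ S.ob k (choice lab q) :=
  ∑ v, S.term k lab true v p q + ∑ v, S.term k lab false v p q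

lemma diff_eq (p q : Idx V) : S.diff k lab p q = ∑ m : Bool × V, S.term k lab m.1 m.2 p q := by
  rw [Fintype.sum_prod_type, Fintype.sum_bool]; rfl

lemma sum_diff_comp (p r : Idx V) : ∑ q, S.diff k lab p q ≫ S.diff k lab q r = 0 := by
  simp only [diff_eq, Preadditive.sum_comp, Preadditive.comp_sum]
  rw [Finset.sum_comm]
  simp only [Finset.sum_comm (s := (Finset.univ : Finset (Idx V)))]
  rw [← Finset.sum_product' (f := fun m' m : Bool × V =>
    ∑ q, S.term k lab m.1 m.2 p q ≫ S.term k lab m'.1 m'.2 q r)]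
  refine Finset.sum_involution (fun x _ => (x.2, x.1)) ?_ ?_ ?_ ?_
  · rintro ⟨m, m'⟩ _
    exact S.sum_term_comp k lab _ _ _ _ _ _
  · rintro ⟨m, m'⟩ _ h e
    simp only [Prod.mk.injEq] at e
    obtain ⟨rfl, _⟩ := e
    exact h (by simp [term_comp_self])
  · simp
  · simp

end Shadow


namespace Shadow

universe u

variable (k : Type u) [CommRing k] {V : Type} (S : Shadow V Y₀ Y₁) (lab : V → Label)

/-- Equal smoothings are the same object. -/
noncomputable def same {f f' : V → Bool} (h : f = f') : S.ob k f ⟶ S.ob k f' :=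
  eqToHom (congrArg (S.ob k) h)

variable {S} in
@[simp] lemma same_refl (f : V → Bool) (h : f = f) : S.same k h = 𝟙 _ := rfl

variable {S} in
@[simp] lemma same_comp {f f' f'' : V → Bool} (h : f = f') (h' : f' = f'') :
    S.same k h ≫ S.same k h' = S.same k (h.trans h') := by
  subst h h'; simp

/-- The predicate that `p` is the index of a summand of the bracket complex in degree `i`. -/
def IsState (i : ℤ) (p : Idx V) : Prop :=
  (∀ v ∈ p.1, lab v = .double) ∧ (p.2.card : ℤ) + 2 * p.1.card = i

/-- The indices of the summands of the bracket complex in degree `i`: a resolution scheme `𝔯` of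
the diagram together with a state `s` of the resolved diagram, where `|s| + 2 |𝔯| = i`. -/
abbrev State (i : ℤ) : Type := {p : Idx V // IsState lab i p}

variable [Fintype V]

/-- The chain objects of the bracket complex. -/
noncomputable def bracketX (i : ℤ) : Cob k Y₀ Y₁ :=
  letI : Fintype (State lab i) := Fintype.ofFinite _
  ⟨State lab i, fun p => S.ob k (choice lab p.1)⟩

/-- A morphism of `Cob k Y₀ Y₁` between sums of smoothings, given by its matrix. -/
noncomputable def mat {lab lab' : V → Label} {i j : ℤ}
    (F : ∀ p q : Idx V, S.ob k (choice lab p) ⟶ S.ob k (choice lab' q)) :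
    S.bracketX k lab i ⟶ S.bracketX k lab' j :=
  fun p q => F p.1 q.1

lemma mat_comp {lab lab' lab'' : V → Label} {i j l : ℤ}
    (F : ∀ p q : Idx V, S.ob k (choice lab p) ⟶ S.ob k (choice lab' q))
    (G : ∀ p q : Idx V, S.ob k (choice lab' p) ⟶ S.ob k (choice lab'' q))
    (p : State lab i) (r : State lab'' l)
    (h : ∀ q, ¬ IsState lab' j q → F p.1 q ≫ G q r.1 = 0) :
    (S.mat k F (i := i) (j := j) ≫ S.mat k G (j := l)) p r = ∑ q, F p.1 q ≫ G q r.1 := by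
  let : Fintype (State lab' j) := Fintype.ofFinite _
  refine Fintype.sum_of_injective (Subtype.val : State lab' j → Idx V) Subtype.val_injective _ _ ?_
    (fun _ => rfl)
  intro q hq
  exact h q fun hq' => hq ⟨⟨q, hq'⟩, rfl⟩

lemma sum_split [DecidableEq V] {M : Type*} [AddCommMonoid M] (b : V) (f : Idx V → M) :
    ∑ q, f q = ∑ q : {q : Idx V // b ∉ q.1}, f q +
      ∑ q : {q : Idx V // b ∉ q.1}, f (insert b q.1.1, q.1.2) := by
  rw [← Fintype.sum_subtype_add_sum_subtype (fun q : Idx V => b ∉ q.1)]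
  congr 1
  symm
  refine Fintype.sum_bijective (fun q => ⟨(insert b q.1.1, q.1.2), by simp⟩) ⟨?_, ?_⟩ _ _
    (fun _ => rfl)
  · rintro ⟨q, hq⟩ ⟨q', hq'⟩ h
    simp only [Subtype.mk.injEq, Prod.mk.injEq] at h
    refine Subtype.ext (Prod.ext ?_ h.2)
    change q.1 = q'.1
    rw [← Finset.erase_insert hq, h.1, Finset.erase_insert hq']
  · rintro ⟨q, hq⟩
    refine ⟨⟨(q.1.erase b, q.2), by simp⟩, ?_⟩
    simp only [not_not] at hq
    simp [Finset.insert_erase hq]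

variable [LinearOrder V]

variable {lab} in
lemma To.isState {κ : Bool} {v : V} {p q : Idx V} (h : To lab κ v p q) {i : ℤ}
    (hp : IsState lab i p) : IsState lab (i + 1) q := by
  obtain ⟨h1, h2⟩ := hp
  cases κ
  · obtain ⟨hv, hr, hs, rfl⟩ := h
    refine ⟨fun w hw => ?_, ?_⟩
    · rcases Finset.mem_insert.1 hw with rfl | hw
      · exact hv
      · exact h1 w hw
    · have := Finset.card_erase_add_one hs
      simp only [Finset.card_insert_of_notMem hr]
      push_cast
      lia
  · obtain ⟨hs, rfl⟩ := h
    refine ⟨h1, ?_⟩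
    simp only [Finset.card_insert_of_notMem hs]
    push_cast
    lia

lemma diff_eq_zero {i j : ℤ} {p q : Idx V} (hp : IsState lab i p)
    (hq : ¬ (i + 1 = j ∧ IsState lab j q)) (hq' : IsState lab j q ∨ i + 1 = j) :
    S.diff k lab p q = 0 := by
  rw [diff_eq]
  refine Finset.sum_eq_zero fun m _ => term_eq_zero fun h => hq ?_
  have h' := h.isState hp
  rcases hq' with h'' | rfl
  · exact ⟨h'.2.symm.trans h''.2, h''⟩
  · exact ⟨rfl, h'⟩

/-- The universal bracket complex `⟦D⟧` of a (singular) tangle diagram with shadow `S` and types of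
vertices `lab`, its summands being `⟦D_𝔯⟧[2|𝔯|]`.  The differential is the sum of the differentials
of the complexes `⟦D_𝔯⟧` and of the genus-one morphisms `⟦D_𝔯⟧ → ⟦D_{𝔯 ∪ b}⟧[1]`. -/
noncomputable def bracket : CochainComplex (Cob k Y₀ Y₁) ℤ where
  X := S.bracketX k lab
  d _ _ := S.mat k (S.diff k lab)
  shape i j h := by
    apply Mat_.hom_ext
    intro p q
    exact S.diff_eq_zero k lab p.2 (fun h' => h h'.1) (Or.inl q.2)
  d_comp_d' i j l hij hjl := by
    apply Mat_.hom_ext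
    intro p r
    refine (S.mat_comp k _ _ p r ?_).trans (S.sum_diff_comp k lab p.1 r.1)
    · intro q hq
      rw [S.diff_eq_zero k lab p.2 (fun h' => hq h'.2) (Or.inr hij), Limits.zero_comp]

/-! ### The genus-one morphism -/

variable {S} in
lemma same_assoc {f f' f'' g : V → Bool} (h : f = f') (h' : f' = f'') (x : S.ob k f'' ⟶ S.ob k g) :
    S.same k h ≫ S.same k h' ≫ x = S.same k (h.trans h') ≫ x := by
  subst h h'; simp

variable {k S} in
lemma sad_same {f g f' g' : V → Bool} {v : V} (h : Toggle f g v) (hf : f = f') (hg : g = g')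
    (h' : Toggle f' g' v) : S.sad k h ≫ S.same k hg = S.same k hf ≫ S.sad k h' := by
  subst hf hg; simp

variable {k S} in
lemma genusOne_same {f g f' g' : V → Bool} {v : V} (h : f = g) (hf : f = f') (hg : g = g')
    (h' : f' = g') : S.genusOne k h v ≫ S.same k hg = S.same k hf ≫ S.genusOne k h' v := by
  subst hf hg; simp

variable {lab} {lab' : V → Label}

lemma term_same {κ : Bool} {v : V} {p q p' q' : Idx V} (hp : choice lab p = choice lab' p')
    (hq : choice lab q = choice lab' q') (hs : p.2 = p'.2)
    (hT : To lab κ v p q ↔ To lab' κ v p' q') :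
    S.term k lab κ v p q ≫ S.same k hq = S.same k hp ≫ S.term k lab' κ v p' q' := by
  by_cases h : To lab κ v p q
  · have h' := hT.1 h
    cases κ
    · rw [term_phi h, term_phi h', hs, Preadditive.zsmul_comp, Preadditive.comp_zsmul,
        genusOne_same _ hp hq (PhiTo.eq h')]
    · rw [term_sad h, term_sad h', hs, Preadditive.zsmul_comp, Preadditive.comp_zsmul,
        sad_same _ hp hq (SadTo.toggle (lab := lab') h')]
  · rw [term_eq_zero h, term_eq_zero (fun h' => h (hT.2 h')), Limits.zero_comp, Limits.comp_zero]

lemma diff_same {p q p' q' : Idx V} (hp : choice lab p = choice lab' p')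
    (hq : choice lab q = choice lab' q') (hs : p.2 = p'.2)
    (hT : ∀ κ v, To lab κ v p q ↔ To lab' κ v p' q') :
    S.diff k lab p q ≫ S.same k hq = S.same k hp ≫ S.diff k lab' p' q' := by
  simp only [diff_eq, Preadditive.sum_comp, Preadditive.comp_sum]
  exact Finset.sum_congr rfl fun m _ => S.term_same k hp hq hs (hT m.1 m.2)

variable (lab) {b : V}

lemma choice_update_neg {p : Idx V} (hb : lab b = .double) (hp : b ∉ p.1) :
    choice (Function.update lab b .neg) p = choice lab p := by
  funext w
  unfold choice
  rw [decide_eq_decide]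
  by_cases hw : w = b
  · subst hw
    simp [IsPos, hb, hp]
  · simp [IsPos, hw]

lemma choice_update_pos {p : Idx V} (hb : lab b = .double) :
    choice (Function.update lab b .pos) p = choice lab (insert b p.1, p.2) := by
  funext w
  unfold choice
  rw [decide_eq_decide]
  by_cases hw : w = b
  · subst hw
    simp [IsPos, hb]
  · simp [IsPos, hw]

lemma choice_neg_pos (p : Idx V) (hb : b ∈ p.2) :
    choice (Function.update lab b .neg) p =
      choice (Function.update lab b .pos) (p.1, p.2.erase b) := by
  funext w
  unfold choice
  rw [decide_eq_decide]
  by_cases hw : w = b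
  · subst hw
    simp [IsPos, hb]
  · simp [IsPos, hw]

lemma to_update_neg {κ : Bool} {v : V} {p q : Idx V} (hp : b ∉ p.1) (hq : b ∉ q.1) :
    To (Function.update lab b .neg) κ v p q ↔ To lab κ v p q := by
  cases κ
  · change PhiTo _ _ _ _ ↔ PhiTo _ _ _ _
    by_cases hv : v = b
    · subst hv
      refine ⟨fun h => by simpa using h.1, fun h => ?_⟩
      rw [h.2.2.2] at hq
      simp at hq
    · simp [PhiTo, hv]
  · exact Iff.rfl

lemma to_update_pos {κ : Bool} {v : V} {p q : Idx V} (hp : b ∉ p.1) (hq : b ∉ q.1) :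
    To (Function.update lab b .pos) κ v p q ↔
      To lab κ v (insert b p.1, p.2) (insert b q.1, q.2) := by
  have key : ∀ r : Finset V, b ∉ r → (insert b q.1 = insert b r ↔ q.1 = r) := by
    intro r hr
    refine ⟨fun h => ?_, fun h => by rw [h]⟩
    rw [← Finset.erase_insert hq, h, Finset.erase_insert hr]
  cases κ
  · change PhiTo _ _ _ _ ↔ PhiTo _ _ _ _
    by_cases hv : v = b
    · subst hv
      simp [PhiTo]
    · have hbv : b ≠ v := fun h => hv h.symm
      simp only [PhiTo, ne_eq, hv, not_false_eq_true, Function.update_of_ne, Finset.mem_insert,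
        false_or, Prod.ext_iff]
      rw [Finset.insert_comm, key _ (by simp [hbv, hp])]
  · change SadTo _ _ _ ↔ SadTo _ _ _
    simp only [SadTo, Prod.ext_iff]
    rw [key _ hp]

lemma to_cross {κ : Bool} {v : V} {p q : Idx V} (hp : b ∉ p.1) (hq : b ∉ q.1)
    (h : To lab κ v p (insert b q.1, q.2)) : κ = false ∧ v = b ∧ q = (p.1, p.2.erase b) := by
  cases κ
  · obtain ⟨h1, h2, h3, h4⟩ := h
    rw [Prod.ext_iff] at h4
    obtain ⟨h4, h5⟩ := h4
    simp only at h4 h5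
    have hv : v = b := by
      have : b ∈ insert v p.1 := h4 ▸ Finset.mem_insert_self _ _
      rcases Finset.mem_insert.1 this with h | h
      · exact h.symm
      · exact absurd h hp
    subst hv
    refine ⟨rfl, rfl, Prod.ext ?_ h5⟩
    rw [← Finset.erase_insert hq, h4, Finset.erase_insert hp]
  · obtain ⟨_, h⟩ := h
    rw [Prod.ext_iff] at h
    exact absurd (h.1 ▸ Finset.mem_insert_self _ _ : b ∈ p.1) hp

lemma not_to_back {κ : Bool} {v : V} {p q : Idx V} (hq : b ∉ q.1) :
    ¬ To lab κ v (insert b p.1, p.2) q := by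
  intro h
  cases κ
  · obtain ⟨_, _, _, rfl⟩ := h
    simp at hq
  · obtain ⟨_, rfl⟩ := h
    simp at hq

open scoped Classical in
/-- The matrix of the genus-one morphism at `b`: from the summand in which the negative crossing `b`
has its `1`-smoothing to the one in which the positive crossing `b` has its `0`-smoothing it is the
morphism `Φ` together with the contraction by `b`. -/
noncomputable def genusOneEntry (b : V) (p q : Idx V) :
    S.ob k (choice (Function.update lab b .neg) p) ⟶
      S.ob k (choice (Function.update lab b .pos) q) :=
  if h : b ∈ p.2 ∧ q = (p.1, p.2.erase b) then
    sgn b p.2 • S.genusOne k ((choice_neg_pos lab p h.1).trans (by rw [h.2])) b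
  else 0

lemma diff_cross {p q : Idx V} (hb : lab b = .double) (hp : b ∉ p.1) (hq : b ∉ q.1) :
    S.diff k lab p (insert b q.1, q.2) = S.same k (choice_update_neg lab hb hp).symm ≫
      S.genusOneEntry k lab b p q ≫ S.same k (choice_update_pos lab hb) := by
  have h1 : S.diff k lab p (insert b q.1, q.2) =
      S.term k lab false b p (insert b q.1, q.2) := by
    rw [diff_eq]
    refine Finset.sum_eq_single (false, b) ?_ (by simp)
    rintro ⟨κ, v⟩ _ hm
    refine term_eq_zero fun h => hm ?_
    obtain ⟨rfl, rfl, _⟩ := to_cross lab hp hq h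
    rfl
  rw [h1]
  unfold genusOneEntry
  split_ifs with h
  · have hT : To lab false b p (insert b q.1, q.2) := ⟨hb, hp, h.1, by rw [h.2]⟩
    rw [term_phi hT, Preadditive.zsmul_comp, Preadditive.comp_zsmul,
      genusOne_same _ (choice_update_neg lab hb hp) (choice_update_pos lab hb) (PhiTo.eq hT),
      same_assoc, same_refl, Category.id_comp]
  · rw [Limits.zero_comp, Limits.comp_zero]
    refine term_eq_zero fun hT => h ⟨hT.2.2.1, (to_cross lab hp hq hT).2.2⟩

lemma diff_neg {p q : Idx V} (hb : lab b = .double) (hp : b ∉ p.1) (hq : b ∉ q.1) :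
    S.diff k lab p q = S.same k (choice_update_neg lab hb hp).symm ≫
      S.diff k (Function.update lab b .neg) p q ≫ S.same k (choice_update_neg lab hb hq) := by
  rw [S.diff_same k (choice_update_neg lab hb hp) (choice_update_neg lab hb hq) rfl
    fun κ v => to_update_neg lab hp hq, same_assoc, same_refl, Category.id_comp]

lemma diff_pos {p q : Idx V} (hb : lab b = .double) (hp : b ∉ p.1) (hq : b ∉ q.1) :
    S.diff k lab (insert b p.1, p.2) (insert b q.1, q.2) =
      S.same k (choice_update_pos lab hb).symm ≫
      S.diff k (Function.update lab b .pos) p q ≫ S.same k (choice_update_pos lab hb) := by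
  rw [S.diff_same k (choice_update_pos lab hb) (choice_update_pos lab hb) rfl
    fun κ v => to_update_pos lab hp hq, same_assoc, same_refl, Category.id_comp]

lemma genusOneEntry_comm (hb : lab b = .double) {p r : Idx V} (hp : b ∉ p.1) (hr : b ∉ r.1) :
    (∑ q : {q : Idx V // b ∉ q.1}, S.genusOneEntry k lab b p q ≫
        S.diff k (Function.update lab b .pos) q r) +
      ∑ q : {q : Idx V // b ∉ q.1}, S.diff k (Function.update lab b .neg) p q ≫
        S.genusOneEntry k lab b q r = 0 := by
  have h := S.sum_diff_comp k lab p (insert b r.1, r.2)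
  rw [sum_split b] at h
  have e1 : ∀ q : {q : Idx V // b ∉ q.1}, S.diff k lab p q ≫ S.diff k lab q (insert b r.1, r.2) =
      S.same k (choice_update_neg lab hb hp).symm ≫
        (S.diff k (Function.update lab b .neg) p q ≫ S.genusOneEntry k lab b q r) ≫
          S.same k (choice_update_pos lab hb) := by
    rintro ⟨q, hq⟩
    rw [S.diff_neg k lab hb hp hq, S.diff_cross k lab hb hq hr]
    simp only [Category.assoc, same_assoc, same_refl, Category.id_comp]
  have e2 : ∀ q : {q : Idx V // b ∉ q.1}, S.diff k lab p (insert b q.1.1, q.1.2) ≫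
        S.diff k lab (insert b q.1.1, q.1.2) (insert b r.1, r.2) =
      S.same k (choice_update_neg lab hb hp).symm ≫
        (S.genusOneEntry k lab b p q ≫ S.diff k (Function.update lab b .pos) q r) ≫
          S.same k (choice_update_pos lab hb) := by
    rintro ⟨q, hq⟩
    rw [S.diff_pos k lab hb hq hr, S.diff_cross k lab hb hp hq]
    simp only [Category.assoc, same_assoc, same_refl, Category.id_comp]
  simp only [e1, e2, ← Preadditive.comp_sum, ← Preadditive.sum_comp, ← Preadditive.comp_add,
    ← Preadditive.add_comp] at h
  have h' := congrArg (fun x => S.same k (choice_update_neg lab hb hp) ≫ x ≫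
    S.same k (choice_update_pos lab hb (p := r)).symm) h
  simp only [Category.assoc, same_comp, same_refl, Category.comp_id, Limits.zero_comp,
    Limits.comp_zero] at h'
  rw [← Category.assoc, same_comp, same_refl, Category.id_comp, add_comm] at h'
  exact h'

lemma IsState.notMem {i : ℤ} {p : Idx V} {x : Label} (hx : x ≠ .double)
    (hp : IsState (Function.update lab b x) i p) : b ∉ p.1 := fun h => by
  have := hp.1 b h
  rw [Function.update_self] at this
  exact hx this

lemma genusOneEntry_isState {i : ℤ} {p q : Idx V}
    (hp : IsState (Function.update lab b .neg) i p)
    (hq : ¬ IsState (Function.update lab b .pos) (i + -1) q) : S.genusOneEntry k lab b p q = 0 := by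
  refine dif_neg ?_
  rintro ⟨hb, rfl⟩
  refine hq ⟨fun v hv => ?_, ?_⟩
  · have hvb : v ≠ b := fun h => hp.notMem lab (by simp) (h ▸ hv)
    have := hp.1 v hv
    rw [Function.update_of_ne hvb] at this ⊢
    exact this
  · have h := hp.2
    have := Finset.card_erase_add_one hb
    simp only
    lia

/-- The genus-one morphism `Φ̂ : ⟦D⁻⟧ → ⟦D⁺⟧[1]` at the double point `b`, where `D⁻` and `D⁺` arise
from `D` by replacing `b` by a negative and a positive crossing.  (The shift `[1]` with
`W[1]ⁱ = Wⁱ⁻¹` is written `⟦-1⟧` in Mathlib.) -/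
noncomputable def genusOneMap (b : V) (hb : lab b = .double) :
    S.bracket k (Function.update lab b .neg) ⟶
      (S.bracket k (Function.update lab b .pos))⟦(-1 : ℤ)⟧ where
  f i := S.mat k (S.genusOneEntry k lab b) (i := i) (j := i + -1)
  comm' i j hij := by
    have hij : i + 1 = j := hij
    change S.mat k (S.genusOneEntry k lab b) (i := i) (j := i + -1) ≫
      ((-1 : ℤ).negOnePow • S.mat k (S.diff k (Function.update lab b .pos))) =
      S.mat k (S.diff k (Function.update lab b .neg)) ≫ S.mat k (S.genusOneEntry k lab b)
    rw [Int.negOnePow_neg, Int.negOnePow_one, Units.neg_smul, one_smul, Preadditive.comp_neg,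
      neg_eq_iff_add_eq_zero]
    apply Mat_.hom_ext
    intro p r
    refine (congrArg₂ (· + ·) (S.mat_comp k _ _ p r ?_) (S.mat_comp k _ _ p r ?_)).trans ?_
    · intro q hq
      rw [S.genusOneEntry_isState k lab p.2 hq, Limits.zero_comp]
    · intro q hq
      rw [S.diff_eq_zero k _ p.2 (fun h => hq h.2) (Or.inr hij), Limits.zero_comp]
    · have hp : b ∉ p.1.1 := p.2.notMem lab (by simp)
      have hr : b ∉ r.1.1 := r.2.notMem lab (by simp)
      refine Eq.trans ?_ (S.genusOneEntry_comm k lab hb hp hr)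
      rw [sum_split b, sum_split b]
      congr 1
      · refine add_eq_left.2 (Finset.sum_eq_zero fun q _ => ?_)
        rw [S.genusOneEntry_isState k lab p.2 (fun h => h.notMem lab (by simp) (by simp)),
          Limits.zero_comp]
        rfl
      · refine add_eq_left.2 (Finset.sum_eq_zero fun q _ => ?_)
        rw [S.diff_eq_zero k _ p.2 (fun h => h.2.notMem lab (by simp) (by simp)) (Or.inr hij),
          Limits.zero_comp]
        rfl

open scoped Classical in
/-- The matrix of the inclusion `⟦D⁺⟧[2] → ⟦D⟧`. -/
noncomputable def inclEntry (b : V) (hb : lab b = .double) (p q : Idx V) :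
    S.ob k (choice (Function.update lab b .pos) p) ⟶ S.ob k (choice lab q) :=
  if h : q = (insert b p.1, p.2) then S.same k ((choice_update_pos lab hb).trans (by rw [h]))
  else 0

open scoped Classical in
/-- The matrix of the projection `⟦D⟧ → ⟦D⁻⟧`. -/
noncomputable def projEntry (b : V) (hb : lab b = .double) (p q : Idx V) :
    S.ob k (choice lab p) ⟶ S.ob k (choice (Function.update lab b .neg) q) :=
  if h : b ∉ p.1 ∧ q = p then S.same k ((choice_update_neg lab hb h.1).symm.trans (by rw [h.2]))
  else 0

lemma inclEntry_isState (hb : lab b = .double) {i : ℤ} {p q : Idx V}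
    (hp : IsState (Function.update lab b .pos) (i + -2) p)
    (hq : ¬ IsState lab i q) : S.inclEntry k lab b hb p q = 0 := by
  have hbp : b ∉ p.1 := hp.notMem lab (by simp)
  refine dif_neg ?_
  rintro rfl
  refine hq ⟨fun v hv => ?_, ?_⟩
  · rcases Finset.mem_insert.1 hv with rfl | hv
    · exact hb
    · have hvb : v ≠ b := fun h => hbp (h ▸ hv)
      have := hp.1 v hv
      rwa [Function.update_of_ne hvb] at this
  · have h := hp.2
    simp only [Finset.card_insert_of_notMem hbp]
    push_cast
    lia

lemma projEntry_isState (hb : lab b = .double) {i : ℤ} {p q : Idx V}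
    (hp : IsState lab i p)
    (hq : ¬ IsState (Function.update lab b .neg) i q) : S.projEntry k lab b hb p q = 0 := by
  refine dif_neg ?_
  rintro ⟨h, rfl⟩
  refine hq ⟨fun v hv => ?_, hp.2⟩
  have hvb : v ≠ b := fun e => h (e ▸ hv)
  rw [Function.update_of_ne hvb]
  exact hp.1 v hv

/-- The inclusion `⟦D⁺⟧[2] → ⟦D⟧` of the summands belonging to resolution schemes which contain the
double point `b`. -/
noncomputable def incl (b : V) (hb : lab b = .double) :
    (S.bracket k (Function.update lab b .pos))⟦(-2 : ℤ)⟧ ⟶ S.bracket k lab where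
  f i := S.mat k (S.inclEntry k lab b hb) (i := i + -2) (j := i)
  comm' i j hij := by
    have hij : i + 1 = j := hij
    change S.mat k (S.inclEntry k lab b hb) (i := i + -2) (j := i) ≫ S.mat k (S.diff k lab) =
      ((-2 : ℤ).negOnePow • S.mat k (S.diff k (Function.update lab b .pos))) ≫
        S.mat k (S.inclEntry k lab b hb)
    rw [Int.negOnePow_even (-2) ⟨-1, rfl⟩, one_smul]
    apply Mat_.hom_ext
    intro p r
    refine ((S.mat_comp k _ _ p r ?_).trans ?_).trans (S.mat_comp k _ _ p r ?_).symm
    · intro q hq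
      rw [S.inclEntry_isState k lab hb p.2 hq, Limits.zero_comp]
    · have hp : b ∉ p.1.1 := p.2.notMem lab (by simp)
      rw [Finset.sum_eq_single (insert b p.1.1, p.1.2) (fun q _ hq => by
        rw [inclEntry, dif_neg hq, Limits.zero_comp]) (by simp)]
      by_cases hr : b ∈ r.1.1
      · obtain ⟨⟨r, s⟩, hrs⟩ := r
        obtain ⟨r₁, hbr, rfl⟩ : ∃ r₁, b ∉ r₁ ∧ r = insert b r₁ :=
          ⟨r.erase b, by simp, (Finset.insert_erase hr).symm⟩
        simp only
        rw [Finset.sum_eq_single (r₁, s)]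
        · rw [inclEntry, dif_pos rfl, inclEntry, dif_pos rfl,
            S.diff_pos k lab hb hp (q := (r₁, s)) hbr, same_assoc, same_refl, Category.id_comp]
        · intro q _ hq
          by_cases hbq : b ∈ q.1
          · rw [S.diff_eq_zero k _ p.2 (fun h => h.2.notMem lab (by simp) hbq)
              (Or.inr rfl), Limits.zero_comp]
          · rw [inclEntry, dif_neg, Limits.comp_zero]
            intro h
            refine hq (Prod.ext ?_ (Prod.ext_iff.1 h).2.symm)
            rw [← Finset.erase_insert hbq, ← (show insert b r₁ = insert b q.1 from (Prod.ext_iff.1 h).1),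
              Finset.erase_insert hbr]
        · simp
      · have : S.diff k lab (insert b p.1.1, p.1.2) r.1 = 0 := by
          rw [diff_eq]
          exact Finset.sum_eq_zero fun m _ => term_eq_zero (not_to_back lab hr)
        rw [this, Limits.comp_zero]
        symm
        refine Finset.sum_eq_zero fun q _ => ?_
        rw [inclEntry, dif_neg, Limits.comp_zero]
        · rfl
        intro h
        rw [h] at hr
        simp at hr
    · intro q hq
      rw [S.diff_eq_zero k _ p.2 (fun h => hq h.2) (Or.inr (by lia)), Limits.zero_comp]

/-- The projection `⟦D⟧ → ⟦D⁻⟧` to the summands belonging to resolution schemes which do not contain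
the double point `b`. -/
noncomputable def proj (b : V) (hb : lab b = .double) :
    S.bracket k lab ⟶ S.bracket k (Function.update lab b .neg) where
  f i := S.mat k (S.projEntry k lab b hb)
  comm' i j hij := by
    have hij : i + 1 = j := hij
    change S.mat k (S.projEntry k lab b hb) ≫ S.mat k (S.diff k (Function.update lab b .neg)) =
      S.mat k (S.diff k lab) ≫ S.mat k (S.projEntry k lab b hb)
    apply Mat_.hom_ext
    intro p r
    refine ((S.mat_comp k _ _ p r ?_).trans ?_).trans (S.mat_comp k _ _ p r ?_).symm
    · intro q hq
      rw [S.projEntry_isState k lab hb p.2 hq, Limits.zero_comp]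
    · have hr : b ∉ r.1.1 := r.2.notMem lab (by simp)
      rw [Finset.sum_eq_single p.1 (fun q _ hq => by
          rw [projEntry, dif_neg (fun h => hq h.2), Limits.zero_comp]) (by simp),
        Finset.sum_eq_single r.1 (fun q _ hq => by
          rw [projEntry, dif_neg (fun h => hq h.2.symm), Limits.comp_zero]) (by simp)]
      by_cases hp : b ∈ p.1.1
      · have : S.diff k lab p.1 r.1 = 0 := by
          have e : p.1 = (insert b p.1.1, p.1.2) := by rw [Finset.insert_eq_of_mem hp]
          rw [diff_eq]
          refine Finset.sum_eq_zero fun m _ => term_eq_zero fun h => ?_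
          rw [e] at h
          exact not_to_back lab hr h
        rw [this, Limits.zero_comp, projEntry, dif_neg (fun h => h.1 hp), Limits.zero_comp]
      · rw [projEntry, dif_pos ⟨hp, rfl⟩, projEntry, dif_pos ⟨hr, rfl⟩, S.diff_neg k lab hb hp hr]
        simp only [Category.assoc, same_comp, same_refl, Category.comp_id]
        rfl
    · intro q hq
      rw [S.diff_eq_zero k _ p.2 (fun h => hq h.2) (Or.inr hij), Limits.zero_comp]

end Shadow

/-! ### Mapping cones and long exact sequences -/

/-- The canonical morphism `Cone(φ) → K[-1]` for `φ : K → L`, the third side of the standard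
triangle of Mathlib (minus the projection to `Kⁱ⁺¹` in degree `i`). -/
noncomputable def coneProj {A : Type*} [Category A] [Preadditive A] [Limits.HasBinaryBiproducts A]
    {K L : CochainComplex A ℤ} (φ : K ⟶ L) : CochainComplex.mappingCone φ ⟶ K⟦(1 : ℤ)⟧ :=
  (CochainComplex.mappingCone.triangle φ).mor₃

/-- The functor `X ↦ Hⁱ(Z(X))` on cochain complexes. -/
noncomputable abbrev homologyOf {C A : Type*} [Category C] [Preadditive C] [Category A] [Abelian A]
    (Z : C ⥤ A) [Z.Additive] (i : ℤ) : CochainComplex C ℤ ⥤ A :=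
  Z.mapHomologicalComplex (ComplexShape.up ℤ) ⋙
    HomologicalComplex.homologyFunctor A (ComplexShape.up ℤ) i

/-! ### Boundedness and the `K`-group -/

/-- A cochain complex which is zero outside a finite range of degrees. -/
def Bounded {A : Type*} [Category A] [Preadditive A] (X : CochainComplex A ℤ) : Prop :=
  ∃ a b : ℤ, ∀ i, i < a ∨ b < i → Limits.IsZero (X.X i)

lemma Bounded.shift {A : Type*} [Category A] [Preadditive A] {X : CochainComplex A ℤ}
    (h : Bounded X) (n : ℤ) : Bounded (X⟦n⟧) := by
  obtain ⟨a, b, h⟩ := h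
  exact ⟨a - n, b - n, fun i hi => h (i + n) (by lia)⟩

section KGroup

variable (A : Type*) [Category A] [Preadditive A] [Limits.HasZeroObject A]
  [Limits.HasBinaryBiproducts A]

/-- The relations `[Y] = [X] + [Z]` for the distinguished triangles `X → Y → Z → X⟦1⟧` in the
homotopy category of bounded complexes. -/
def triangleRelations : Set (FreeAbelianGroup {X : CochainComplex A ℤ // Bounded X}) :=
  {x | ∃ (X Y Z : {X : CochainComplex A ℤ // Bounded X})
    (T : Pretriangulated.Triangle (HomotopyCategory A (ComplexShape.up ℤ))),
    T ∈ Pretriangulated.distinguishedTriangles ∧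
    T.obj₁ = (HomotopyCategory.quotient A _).obj X.1 ∧
    T.obj₂ = (HomotopyCategory.quotient A _).obj Y.1 ∧
    T.obj₃ = (HomotopyCategory.quotient A _).obj Z.1 ∧
    x = FreeAbelianGroup.of Y - FreeAbelianGroup.of X - FreeAbelianGroup.of Z}

/-- The Grothendieck group of the (triangulated) homotopy category of bounded cochain complexes. -/
abbrev KGroup : Type _ :=
  FreeAbelianGroup {X : CochainComplex A ℤ // Bounded X} ⧸
    AddSubgroup.closure (triangleRelations A)

variable {A} in
/-- The class of a bounded complex in the `K`-group. -/
def KGroup.mk (X : CochainComplex A ℤ) (h : Bounded X) : KGroup A :=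
  QuotientAddGroup.mk (FreeAbelianGroup.of ⟨X, h⟩)

end KGroup

noncomputable instance (k : Type*) [CommRing k] : Limits.HasFiniteBiproducts (Cob k Y₀ Y₁) :=
  inferInstanceAs (Limits.HasFiniteBiproducts (Mat_ (KCob k Y₀ Y₁)))

instance (k : Type*) [CommRing k] : Limits.HasZeroObject (Cob k Y₀ Y₁) :=
  Limits.hasZeroObject_of_hasFiniteBiproducts _

instance (k : Type*) [CommRing k] : Limits.HasBinaryBiproducts (Cob k Y₀ Y₁) :=
  Limits.hasBinaryBiproducts_of_finite_biproducts _

/-! ### Singular tangle diagrams -/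

/-- An oriented singular tangle diagram: each of its vertices is a negative crossing, a positive
crossing or a double point.  The total order on the vertices fixes the signs in the bracket
complex. -/
structure SingDiagram (l l' : List Bool) where
  shape : Shape l l'
  label : shape.V → Label
  order : LinearOrder shape.V

namespace SingDiagram

universe u

variable {l l' : List Bool} (D : SingDiagram l l') (k : Type u) [CommRing k]

/-- The diagram `D` with the type of the vertex `b` replaced by `x`. -/
def resolve (b : D.shape.V) (x : Label) : SingDiagram l l' where
  shape := D.shape
  label := letI := D.order; Function.update D.label b x
  order := D.order

/-- The universal bracket complex `⟦D^χ⟧`; for `c = true` the checkerboard colouring `χ` is the one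
with negatively unbounded white region, and for `c = false` it is the opposite one. -/
noncomputable def bracket (c : Bool) : CochainComplex (Cob k (bdry c l) (bdry c l')) ℤ :=
  letI := D.order
  (D.shape.shadow c).bracket k D.label

/-- The number of vertices with a given label. -/
noncomputable def count (x : Label) : ℕ := Nat.card {v // D.label v = x}

/-- `n₋ + 2 n_×`, with `n₋` the number of negative crossings and `n_×` that of double points. -/
noncomputable def weight : ℤ := D.count .neg + 2 * D.count .double

/-- The universal Khovanov complex `⟦D^χ⟧[-n₋ - 2 n_×]`.  (The shift `[m]` with `W[m]ⁱ = Wⁱ⁻ᵐ` is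
written `⟦-m⟧` in Mathlib.) -/
noncomputable def Kh : CochainComplex (Cob k (bdry true l) (bdry true l')) ℤ :=
  (D.bracket k true)⟦D.weight⟧

variable {b : D.shape.V}

variable {D} in
lemma weight_resolve (hb : D.label b = .double) :
    -1 + (D.resolve b .neg).weight = (D.resolve b .pos).weight := by
  classical
  let := D.order
  have key : ∀ x y : Label, ((D.resolve b x).count y : ℤ) = D.count y +
      (if x = y then 1 else 0) - (if y = .double then 1 else 0) := by
    intro x y
    have h1 : (D.resolve b x).count y = (Finset.univ.filter
        (fun v => Function.update D.label b x v = y)).card :=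
      (Nat.card_eq_fintype_card (α := {v // Function.update D.label b x v = y})).trans
        (Fintype.card_subtype _)
    have h2 : D.count y = (Finset.univ.filter (fun v => D.label v = y)).card :=
      (Nat.card_eq_fintype_card (α := {v // D.label v = y})).trans (Fintype.card_subtype _)
    rw [h1, h2, Finset.card_filter, Finset.card_filter,
      ← Finset.add_sum_erase _ _ (Finset.mem_univ b),
      ← Finset.add_sum_erase _ (fun v => if D.label v = y then 1 else 0) (Finset.mem_univ b),
      Finset.sum_congr rfl (g := fun v => if D.label v = y then 1 else 0)
        (fun v hv => by rw [Function.update_of_ne (Finset.ne_of_mem_erase hv)]),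
      Function.update_self, hb]
    push_cast
    have e : (Label.double = y) = (y = Label.double) := propext eq_comm
    simp only [e]
    ring
  unfold weight
  rw [key, key, key, key]
  simp
  ring

/-- The genus-one morphism `Φ̂ : ⟦D⁻⟧ → ⟦D⁺⟧[1]`. -/
noncomputable def genusOne (hb : D.label b = .double) (c : Bool) :
    (D.resolve b .neg).bracket k c ⟶ ((D.resolve b .pos).bracket k c)⟦(-1 : ℤ)⟧ :=
  letI := D.order
  (D.shape.shadow c).genusOneMap k D.label b hb

/-- The inclusion `b_† : ⟦D⁺⟧[2] → ⟦D⟧`. -/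
noncomputable def incl (hb : D.label b = .double) (c : Bool) :
    ((D.resolve b .pos).bracket k c)⟦(-2 : ℤ)⟧ ⟶ D.bracket k c :=
  letI := D.order
  (D.shape.shadow c).incl k D.label b hb

/-- The projection `⟦D⟧ → ⟦D⁻⟧`. -/
noncomputable def proj (hb : D.label b = .double) (c : Bool) : D.bracket k c ⟶ (D.resolve b .neg).bracket k c :=
  letI := D.order
  (D.shape.shadow c).proj k D.label b hb

/-- The genus-one morphism `Φ̂ : Kh(D⁻) → Kh(D⁺)`. -/
noncomputable def KhGenusOne (hb : D.label b = .double) : (D.resolve b .neg).Kh k ⟶ (D.resolve b .pos).Kh k :=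
  (D.genusOne k hb true)⟦(D.resolve b .neg).weight⟧' ≫
    (shiftFunctorAdd' (CochainComplex (Cob k (bdry true l) (bdry true l')) ℤ) (-1)
      (D.resolve b .neg).weight (D.resolve b .pos).weight (weight_resolve hb)).inv.app
        ((D.resolve b .pos).bracket k true)

lemma bracket_bounded (c : Bool) : Bounded (D.bracket k c) := by
  let := D.order
  refine ⟨0, 3 * Fintype.card D.shape.V, fun i hi => ?_⟩
  have hE : IsEmpty (Shadow.State D.label i) := by
    refine ⟨fun p => ?_⟩
    have h := p.2.2
    have h1 := Finset.card_le_univ p.1.1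
    have h2 := Finset.card_le_univ p.1.2
    lia
  rw [Limits.IsZero.iff_id_eq_zero]
  apply Mat_.hom_ext
  intro p
  exact hE.elim p

lemma Kh_bounded : Bounded (D.Kh k) := (D.bracket_bounded k true).shift _

/-- The class of `Kh(D)` in the `K`-group. -/
noncomputable def KhClass : KGroup (Cob k (bdry true l) (bdry true l')) :=
  KGroup.mk (D.Kh k) (D.Kh_bounded k)

end SingDiagram

end UKh

/-! Sort the summands of the bracket of `D` by whether the resolution scheme 𝔯 contains `b`. The
summands with `b ∉ 𝔯` are those of ⟦D⁻⟧, and the summands with `b ∈ 𝔯` are those of ⟦D⁺⟧[2], because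
`b` contributes 2 to the degree |s| + 2|𝔯|. The differential is triangular for this splitting. No
term removes `b` from 𝔯, the diagonal blocks are the differentials of the two resolved brackets, and
the only term that inserts `b` into 𝔯 is the genus-one morphism at `b`, so the remaining block is
Φ̂. Thus ⟦D⟧ is an extension of ⟦D⁻⟧ by ⟦D⁺⟧[2] which splits in each degree, and such an extension
is a shifted mapping cone of its off-diagonal block.

The general fact is isolated in `ConeSplitting` and `ConeSplitting.iso`, with `ι_iso` and
`iso_coneProj` identifying the maps into and out of the cone. The bracket complex satisfies its
axioms by `coneSplitting`; the essential one is `mat_sect_comp_diff_comp_retr`, which computes the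
off-diagonal block and rests on `diff_cross`.

For the Khovanov complex, the number n₋ + 2n_× of D⁻ is one less than that of `D`, and that of D⁺ is
two less. Hence the normalising shifts absorb the shift of the cone, and `KhIso` identifies Kh(D)
with the unshifted cone of `KhGenusOne`. The rest is formal. The cone triangle is distinguished, an
additive functor induces a triangulated functor of homotopy categories on which homology is
homological, and the relation in the Grothendieck group is the one imposed by this triangle. -/

namespace UKh

/-! ### Degreewise split extensions are shifted mapping cones. -/

section Cone

open CochainComplex CochainComplex.HomComplex

variable {C : Type*} [Category C] [Preadditive C] {B K L : CochainComplex C ℤ}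

/-- A degreewise splitting of a complex `B` which exhibits it as an extension of `K` by the shift
`L⟦-1⟧` with classifying morphism `φ`. -/
structure ConeSplitting (φ : K ⟶ L) (B : CochainComplex C ℤ) where
  ι : ∀ i, L.X (i + -1) ⟶ B.X i
  π : B ⟶ K
  σ : ∀ i, K.X i ⟶ B.X i
  ρ : ∀ i, B.X i ⟶ L.X (i + -1)
  -- The sign is that of the differential of `L⟦-1⟧`: the condition says that `ι` is a chain map
  -- from this shift.
  ι_d : ∀ i j, i + 1 = j → ι i ≫ B.d i j = -(L.d (i + -1) (j + -1) ≫ ι j)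
  ι_ρ : ∀ i, ι i ≫ ρ i = 𝟙 _
  σ_π : ∀ i, σ i ≫ π.f i = 𝟙 _
  decomp : ∀ i, ρ i ≫ ι i + π.f i ≫ σ i = 𝟙 _
  -- The off-diagonal block of the differential; the transport only identifies degree `i` of `L`
  -- with degree `j + -1`.
  σ_d_ρ : ∀ i j (h : j + -1 = i), σ i ≫ B.d i j ≫ ρ j =
    φ.f i ≫ (HomologicalComplex.XIsoOfEq L h).inv

namespace ConeSplitting

variable {φ : K ⟶ L} (s : ConeSplitting φ B)

/-- Sandwiching `decomp` between `ι` and `π` gives `ι ≫ π + ι ≫ π = ι ≫ π`. The same argument with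
`σ` and `ρ` gives `σ_ρ`, so neither relation is needed as an axiom. -/
lemma ι_π (i : ℤ) : s.ι i ≫ s.π.f i = 0 := by
  have h := s.ι i ≫= s.decomp i =≫ s.π.f i
  simpa [reassoc_of% (s.ι_ρ i), s.σ_π i] using h

lemma σ_ρ (i : ℤ) : s.σ i ≫ s.ρ i = 0 := by
  have h := s.σ i ≫= s.decomp i =≫ s.ρ i
  simpa [reassoc_of% (s.σ_π i), s.ι_ρ i] using h

/-- Inserting `decomp` in front of the differential reduces the claim to the two summands: after `ι`
one sees the differential of `L` with its sign, after `σ` the classifying morphism. -/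
lemma d_ρ (j : ℤ) : B.d (j + -1) j ≫ s.ρ j =
    s.π.f (j + -1) ≫ φ.f (j + -1) - s.ρ (j + -1) ≫ L.d (j + -1 + -1) (j + -1) := by
  have hι : s.ι (j + -1) ≫ B.d (j + -1) j ≫ s.ρ j = - L.d (j + -1 + -1) (j + -1) := by
    rw [← Category.assoc, s.ι_d _ _ (by lia), Preadditive.neg_comp, Category.assoc, s.ι_ρ,
      Category.comp_id]
  have hσ : s.σ (j + -1) ≫ B.d (j + -1) j ≫ s.ρ j = φ.f (j + -1) := by
    rw [s.σ_d_ρ _ _ rfl]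
    exact Category.comp_id _
  rw [← Category.id_comp (B.d (j + -1) j), ← s.decomp, Preadditive.add_comp,
    Preadditive.add_comp]
  simp only [Category.assoc]
  rw [hι, hσ, Preadditive.comp_neg]
  abel

variable [Limits.HasBinaryBiproducts C]

/-- The identification of `B` with a shifted mapping cone, in a single degree. -/
noncomputable def XIso (i : ℤ) : B.X i ≅ (mappingCone φ).X (i + -1) where
  -- The shift by `-1` negates the differential of the cone and with it the component `φ`. The minus
  -- sign on the summand `K` restores `φ`; it also cancels the sign built into `coneProj`.
  hom := s.ρ i ≫ (mappingCone.inr φ).f (i + -1) -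
    s.π.f i ≫ (mappingCone.inl φ).v i (i + -1) rfl
  inv := (mappingCone.snd φ).v (i + -1) (i + -1) (add_zero _) ≫ s.ι i -
    (mappingCone.fst φ).1.v (i + -1) i (by lia) ≫ s.σ i
  hom_inv_id := by
    have h := s.decomp i
    simpa [Preadditive.sub_comp, Preadditive.comp_sub] using h
  inv_hom_id := by
    refine mappingCone.ext_from φ i (i + -1) (by lia) ?_ ?_
    · simp [Preadditive.sub_comp, Preadditive.comp_sub, reassoc_of% (s.σ_ρ i),
        reassoc_of% (s.σ_π i)]
    · simp [Preadditive.sub_comp, Preadditive.comp_sub, reassoc_of% (s.ι_π i),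
        reassoc_of% (s.ι_ρ i)]

/-- Compatibility with the unshifted differential of the cone, hence only up to sign. The `φ` term
of `d_ρ` matches the one in the differential of `inl`, and the terms in `K` agree because `π` is a
chain map. -/
lemma XIso_hom_d (j : ℤ) : (s.XIso (j + -1)).hom ≫ (mappingCone φ).d (j + -1 + -1) (j + -1) =
    -(B.d (j + -1) j ≫ (s.XIso j).hom) := by
  simp only [XIso, Preadditive.sub_comp, Preadditive.comp_sub, Category.assoc,
    mappingCone.inr_f_d, reassoc_of% (s.d_ρ j),
    mappingCone.inl_v_d φ (j + -1) (j + -1 + -1) j rfl rfl, s.π.comm_assoc]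
  abel

/-- An extension of `K` by `L⟦-1⟧` is the shifted mapping cone of the classifying morphism. -/
noncomputable def iso : B ≅ (mappingCone φ)⟦(-1 : ℤ)⟧ :=
  HomologicalComplex.Hom.isoOfComponents s.XIso (by
    intro i j hij
    obtain rfl : i = j + -1 := by have : i + 1 = j := hij; lia
    -- The sign of the shifted differential, made explicit, cancels the one in `XIso_hom_d`.
    change (s.XIso (j + -1)).hom ≫ ((-1 : ℤ).negOnePow • (mappingCone φ).d (j + -1 + -1) (j + -1)) =
      B.d (j + -1) j ≫ (s.XIso j).hom
    rw [Int.negOnePow_neg, Int.negOnePow_one, Units.neg_smul, one_smul, Preadditive.comp_neg,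
      s.XIso_hom_d, neg_neg])

lemma ι_iso (i : ℤ) : s.ι i ≫ (s.XIso i).hom = (mappingCone.inr φ).f (i + -1) := by
  simp [XIso, Preadditive.comp_sub, reassoc_of% (s.ι_π i), reassoc_of% (s.ι_ρ i)]

lemma iso_coneProj (i : ℤ) : (s.XIso i).hom ≫ (coneProj φ).f (i + -1) =
    s.π.f i ≫ (HomologicalComplex.XIsoOfEq K (show i + -1 + 1 = i by lia)).inv := by
  -- Only the values on `inl` and `inr` matter. An arbitrary `p` has its target written as a
  -- component of `K` itself, not of `K⟦1⟧`. Its value on `inl` is negative, as is the coefficient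
  -- of `inl` in `XIso`.
  have key : ∀ p : (mappingCone φ).X (i + -1) ⟶ K.X (i + -1 + 1),
      (mappingCone.inl φ).v i (i + -1) rfl ≫ p =
        -(HomologicalComplex.XIsoOfEq K (show i + -1 + 1 = i by lia)).inv →
      (mappingCone.inr φ).f (i + -1) ≫ p = 0 → (s.XIso i).hom ≫ p =
        s.π.f i ≫ (HomologicalComplex.XIsoOfEq K (show i + -1 + 1 = i by lia)).inv := by
    intro p h₁ h₂
    simp [XIso, Preadditive.sub_comp, h₁, h₂]
  exact key _ (mappingCone.inl_v_triangle_mor₃_f φ i (i + -1) rfl)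
    (mappingCone.inr_f_triangle_mor₃_f φ (i + -1))

end ConeSplitting

end Cone

/-! ### Matrices and states for the splitting of the bracket at a double point. -/

namespace Shadow

universe u

variable (k : Type u) [CommRing k] {Y₀ Y₁ : Points} {V : Type} (S : Shadow V Y₀ Y₁)
  (lab : V → Label) [Fintype V] [LinearOrder V] {b : V}

open scoped Classical in
/-- The matrix of the retraction `⟦D⟧ → ⟦D⁺⟧[2]`. -/
noncomputable def retrEntry (b : V) (hb : lab b = .double) (p q : Idx V) :
    S.ob k (choice lab p) ⟶ S.ob k (choice (Function.update lab b .pos) q) :=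
  if h : p = (insert b q.1, q.2) then
    S.same k ((by rw [h] : choice lab p = _).trans (choice_update_pos lab hb).symm)
  else 0

open scoped Classical in
/-- The matrix of the section `⟦D⁻⟧ → ⟦D⟧`. -/
noncomputable def sectEntry (b : V) (hb : lab b = .double) (p q : Idx V) :
    S.ob k (choice (Function.update lab b .neg) p) ⟶ S.ob k (choice lab q) :=
  if h : b ∉ p.1 ∧ q = p then S.same k ((choice_update_neg lab hb h.1).trans (by rw [h.2]))
  else 0

variable {lab} in
lemma IsState.update {x : Label} {i : ℤ} {p : Idx V} (hp : IsState lab i p) (h : b ∉ p.1) :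
    IsState (Function.update lab b x) i p := by
  refine ⟨fun v hv => ?_, hp.2⟩
  have e : v ≠ b := by rintro rfl; exact h hv
  rw [Function.update_of_ne e]
  exact hp.1 v hv

-- Once `b` is a crossing, no resolution scheme contains it (`IsState.notMem`), so only labels away
-- from `b` are tested.
variable {lab} in
lemma IsState.of_update {x : Label} (hx : x ≠ .double) {i : ℤ} {p : Idx V}
    (hp : IsState (Function.update lab b x) i p) : IsState lab i p := by
  refine ⟨fun v hv => ?_, hp.2⟩
  have := hp.1 v hv
  have e : v ≠ b := by rintro rfl; exact hp.notMem lab hx hv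
  rwa [Function.update_of_ne e] at this

-- In the degree |s| + 2|𝔯|, adding `b` to 𝔯 accounts for the shift [2] of ⟦D⁺⟧.
variable {lab} in
lemma IsState.insert (hb : lab b = .double) {i j : ℤ} (hij : i + 2 = j) {p : Idx V}
    (hp : IsState lab i p) (h : b ∉ p.1) : IsState lab j (Insert.insert b p.1, p.2) := by
  refine ⟨fun v hv => ?_, ?_⟩
  · rcases Finset.mem_insert.1 hv with rfl | hv
    · exact hb
    · exact hp.1 v hv
  · have := hp.2
    simp only [Finset.card_insert_of_notMem h]
    push_cast
    lia

variable {lab} in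
lemma IsState.of_insert {i j : ℤ} (hij : i + 2 = j) {p : Idx V} (h : b ∉ p.1)
    (hp : IsState lab j (Insert.insert b p.1, p.2)) : IsState lab i p := by
  refine ⟨fun v hv => hp.1 v (Finset.mem_insert_of_mem hv), ?_⟩
  have := hp.2
  simp only [Finset.card_insert_of_notMem h] at this
  push_cast at this
  lia

lemma insert_eq_iff {p q : Idx V} (hp : b ∉ p.1) (hq : b ∉ q.1) :
    ((insert b p.1, p.2) : Idx V) = (insert b q.1, q.2) ↔ p = q := by
  refine ⟨fun h => ?_, fun h => by rw [h]⟩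
  obtain ⟨h₁, h₂⟩ := Prod.ext_iff.1 h
  refine Prod.ext ?_ h₂
  rw [← Finset.erase_insert hp, show insert b p.1 = insert b q.1 from h₁, Finset.erase_insert hq]

section Matrices

variable {k S} {lab}
variable {lab' lab'' : V → Label} {i j l : ℤ}
  {F : ∀ p q : Idx V, S.ob k (choice lab p) ⟶ S.ob k (choice lab' q)}
  {G : ∀ p q : Idx V, S.ob k (choice lab' p) ⟶ S.ob k (choice lab'' q)}

/-- On states, the inclusion, retraction, projection and section matrices have at most one nonzero
entry in each row and column, so products with them collapse. In contrast to `mat_comp`, the sum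
stays on states of degree `j`, and nothing has to vanish outside them. -/
lemma mat_comp_eq_single (p : State lab i) (r : State lab'' l) (q₀ : State lab' j)
    (h : ∀ q : State lab' j, q ≠ q₀ → F p.1 q.1 = 0 ∨ G q.1 r.1 = 0) :
    (S.mat k F (i := i) (j := j) ≫ S.mat k G (j := l)) p r = F p.1 q₀.1 ≫ G q₀.1 r.1 := by
  -- The instance chosen in `bracketX`, so that the composite is this finite sum by definition.
  let : Fintype (State lab' j) := Fintype.ofFinite _
  refine Finset.sum_eq_single (M := S.ob k (choice lab p.1) ⟶ S.ob k (choice lab'' r.1))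
    q₀ (fun q _ hq => ?_) (fun h => absurd (Finset.mem_univ _) h)
  change F p.1 q.1 ≫ G q.1 r.1 = 0
  rcases h q hq with h | h
  · rw [h, Limits.zero_comp]
  · rw [h, Limits.comp_zero]

lemma mat_comp_eq_zero (p : State lab i) (r : State lab'' l)
    (h : ∀ q : State lab' j, F p.1 q.1 = 0 ∨ G q.1 r.1 = 0) :
    (S.mat k F (i := i) (j := j) ≫ S.mat k G (j := l)) p r = 0 := by
  let : Fintype (State lab' j) := Fintype.ofFinite _
  refine Finset.sum_eq_zero (M := S.ob k (choice lab p.1) ⟶ S.ob k (choice lab'' r.1))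
    (fun q _ => ?_)
  change F p.1 q.1 ≫ G q.1 r.1 = 0
  rcases h q with h | h
  · rw [h, Limits.zero_comp]
  · rw [h, Limits.comp_zero]

-- The identity in the form in which products of the matrices come out: a condition on underlying
-- indices and a `same`.
open scoped Classical in
lemma id_bracketX_apply (p q : State lab i) : (𝟙 (S.bracketX k lab i) : Mat_.Hom _ _) p q =
    if h : p.1 = q.1 then S.same k (by rw [h]) else 0 := by
  by_cases h : p = q
  · subst h
    rw [dif_pos rfl]
    exact Mat_.id_apply_self (S.bracketX k lab i) p
  · rw [dif_neg (fun e => h (Subtype.ext e))]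
    exact Mat_.id_apply_of_ne (S.bracketX k lab i) p q h

end Matrices

/-! ### The splitting identities and the off-diagonal block. -/

lemma mat_incl_comp_retr (hb : lab b = .double) {i j : ℤ} (hij : i + 2 = j) :
    S.mat k (S.inclEntry k lab b hb) (i := i) (j := j) ≫ S.mat k (S.retrEntry k lab b hb) =
      𝟙 _ := by
  apply Mat_.hom_ext
  intro p r
  have hp : b ∉ p.1.1 := p.2.notMem lab (by simp)
  have hr : b ∉ r.1.1 := r.2.notMem lab (by simp)
  -- Row `p` of the inclusion has its only entry at the scheme with `b` added.
  refine (mat_comp_eq_single p r ⟨_, (p.2.of_update (by simp)).insert hb hij hp⟩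
    (fun q hq => Or.inl (dif_neg fun h => hq (Subtype.ext h)))).trans ?_
  refine Eq.trans ?_ (id_bracketX_apply p r).symm
  rw [inclEntry, dif_pos rfl, retrEntry]
  split_ifs with h₁ h₂ h₂
  · rw [same_comp]
  · exact absurd ((insert_eq_iff hp hr).1 h₁) h₂
  · exact absurd ((insert_eq_iff hp hr).2 h₂) h₁
  · rw [Limits.comp_zero]

lemma mat_sect_comp_proj (hb : lab b = .double) {i : ℤ} :
    S.mat k (S.sectEntry k lab b hb) (i := i) (j := i) ≫ S.mat k (S.projEntry k lab b hb) =
      𝟙 _ := by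
  apply Mat_.hom_ext
  intro p r
  have hp : b ∉ p.1.1 := p.2.notMem lab (by simp)
  refine (mat_comp_eq_single p r ⟨_, p.2.of_update (by simp)⟩
    (fun q hq => Or.inl (dif_neg fun h => hq (Subtype.ext h.2)))).trans ?_
  refine Eq.trans ?_ (id_bracketX_apply p r).symm
  rw [sectEntry, dif_pos ⟨hp, rfl⟩, projEntry]
  split_ifs with h₁ h₂ h₂
  · rw [same_comp]
  · exact absurd h₁.2.symm h₂
  · exact absurd ⟨hp, h₂.symm⟩ h₁
  · rw [Limits.comp_zero]

/-- Every summand of the bracket of `D` is of exactly one kind. On those with `b ∈ 𝔯` the first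
product is the identity and the second vanishes; on the others the roles are exchanged. -/
lemma mat_retr_comp_incl_add (hb : lab b = .double) {i j : ℤ} (hij : i + 2 = j) :
    S.mat k (S.retrEntry k lab b hb) (i := j) (j := i) ≫ S.mat k (S.inclEntry k lab b hb) +
      S.mat k (S.projEntry k lab b hb) (i := j) (j := j) ≫ S.mat k (S.sectEntry k lab b hb) =
      𝟙 _ := by
  apply Mat_.hom_ext
  intro p r
  refine Eq.trans ?_ (id_bracketX_apply p r).symm
  by_cases hp : b ∈ p.1.1
  · obtain ⟨⟨p₁, s⟩, hps⟩ := p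
    obtain ⟨p₁, hbp, rfl⟩ : ∃ p₂, b ∉ p₂ ∧ p₁ = insert b p₂ :=
      ⟨p₁.erase b, by simp, (Finset.insert_erase hp).symm⟩
    refine (congrArg₂ (· + ·) (mat_comp_eq_single (F := S.retrEntry k lab b hb)
      (G := S.inclEntry k lab b hb) _ r
      ⟨(p₁, s), (IsState.of_insert hij hbp hps).update hbp⟩ (fun q hq => Or.inl (dif_neg fun h => ?_)))
      (mat_comp_eq_zero (F := S.projEntry k lab b hb) (G := S.sectEntry k lab b hb) _ r
        fun q => Or.inl (dif_neg fun h => h.1 hp))).trans ?_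
    -- The intermediate state is unique because states of D⁺ avoid `b`; among all indices, one
    -- containing `b` would also satisfy the condition of `retrEntry`.
    · exact hq (Subtype.ext ((insert_eq_iff (p := (p₁, s)) hbp
        (q.2.notMem lab (by simp))).1 h).symm)
    · rw [retrEntry, dif_pos rfl, inclEntry]
      refine (add_zero _).trans ?_
      split_ifs with h₁ h₂ h₂
      · rw [same_comp]
      · exact absurd h₁.symm h₂
      · exact absurd h₂.symm h₁
      · rw [Limits.comp_zero]
  · refine (congrArg₂ (· + ·) (mat_comp_eq_zero (F := S.retrEntry k lab b hb)
        (G := S.inclEntry k lab b hb) p r fun q => Or.inl (dif_neg fun h => hp ?_))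
      (mat_comp_eq_single (F := S.projEntry k lab b hb) (G := S.sectEntry k lab b hb) p r ⟨p.1, p.2.update hp⟩
        (fun q hq => Or.inl (dif_neg fun h => hq (Subtype.ext h.2))))).trans ?_
    · rw [h]; simp
    · rw [projEntry, dif_pos ⟨hp, rfl⟩, sectEntry]
      refine (zero_add _).trans ?_
      split_ifs with h₁ h₂ h₂
      · rw [same_comp]
      · exact absurd h₁.2.symm h₂
      · exact absurd ⟨hp, h₂.symm⟩ h₁
      · rw [Limits.comp_zero]

/-- This is where the classifying morphism is found. By `diff_cross`, the only term of the
differential that inserts `b` is the genus-one morphism at `b`; the identifications of smoothings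
coming from section and retraction cancel those in `diff_cross`. -/
lemma mat_sect_comp_diff_comp_retr (hb : lab b = .double) {i j l : ℤ} (hij : i + 1 = j)
    (hjl : l + 2 = j) :
    S.mat k (S.sectEntry k lab b hb) (i := i) (j := i) ≫ S.mat k (S.diff k lab) (j := j) ≫
      S.mat k (S.retrEntry k lab b hb) (j := l) = S.mat k (S.genusOneEntry k lab b) := by
  have hσ : S.mat k (S.sectEntry k lab b hb) (i := i) (j := i) ≫ S.mat k (S.diff k lab) (j := j) =
      S.mat k (fun p q => if h : b ∉ p.1 then
        S.same k (choice_update_neg lab hb h) ≫ S.diff k lab p q else 0) := by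
    apply Mat_.hom_ext
    intro p q
    have hp : b ∉ p.1.1 := p.2.notMem lab (by simp)
    refine (mat_comp_eq_single p q ⟨_, p.2.of_update (by simp)⟩
      (fun q hq => Or.inl (dif_neg fun h => hq (Subtype.ext h.2)))).trans ?_
    rw [sectEntry, dif_pos ⟨hp, rfl⟩, mat, dif_pos hp]
  rw [← Category.assoc, hσ]
  apply Mat_.hom_ext
  intro p r
  have hp : b ∉ p.1.1 := p.2.notMem lab (by simp)
  have hr : b ∉ r.1.1 := r.2.notMem lab (by simp)
  -- Now the single nonzero entry is in column `r` of the retraction; the row of the other factor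
  -- may have many.
  refine (mat_comp_eq_single p r ⟨_, (r.2.of_update (by simp)).insert hb hjl hr⟩
    (fun q hq => Or.inr (dif_neg fun h => hq (Subtype.ext h)))).trans ?_
  rw [dif_pos hp, retrEntry, dif_pos rfl, S.diff_cross k lab hb hp hr]
  simp only [Category.assoc, same_comp, same_refl, Category.comp_id, same_assoc, Category.id_comp]
  rfl

/-- The commutation built into `incl`, whose shift by `-2` has trivial sign. The degrees are free
variables because the double shift in `coneSplitting` produces `i + -1 + -1`, which is not `i + -2`
by definition. -/
lemma mat_incl_comp_diff (hb : lab b = .double) {i j i' j' : ℤ} (hij : i + 1 = j)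
    (hi : i' = i + -2) (hj : j' = j + -2) :
    S.mat k (S.inclEntry k lab b hb) (i := i') (j := i) ≫ S.mat k (S.diff k lab) (j := j) =
      S.mat k (S.diff k (Function.update lab b .pos)) (j := j') ≫
        S.mat k (S.inclEntry k lab b hb) := by
  subst hi hj
  have h : _ = (((-2 : ℤ).negOnePow • S.mat k (S.diff k _)) ≫ _) :=
    (S.incl k lab b hb).comm i j
  rwa [Int.negOnePow_even (-2) ⟨-1, rfl⟩, one_smul] at h

/-- The entries of `mat` do not depend on the degree, so a matrix absorbs the re-indexing that comes
with shift isomorphisms. -/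
lemma XIsoOfEq_bracket_comp_mat {lab' : V → Label} {i i' j : ℤ} (h : i = i')
    (F : ∀ p q : Idx V, S.ob k (choice lab p) ⟶ S.ob k (choice lab' q)) :
    (HomologicalComplex.XIsoOfEq (S.bracket k lab) h).hom ≫ S.mat k F (i := i') (j := j) =
      S.mat k F := by
  subst h
  exact Category.id_comp _

/-! ### The bracket complex as a shifted cone, with its canonical maps. -/

/-- The bracket complex as an extension classified by the genus-one morphism. -/
noncomputable def coneSplitting (hb : lab b = .double) :
    ConeSplitting (S.genusOneMap k lab b hb) (S.bracket k lab) where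
  -- Here `L` is already the bracket of D⁺ shifted by `-1`, hence the second `-1`.
  ι i := S.mat k (S.inclEntry k lab b hb) (i := i + -1 + -1) (j := i)
  π := S.proj k lab b hb
  σ i := S.mat k (S.sectEntry k lab b hb)
  ρ i := S.mat k (S.retrEntry k lab b hb) (i := i) (j := i + -1 + -1)
  ι_d i j hij := by
    refine (S.mat_incl_comp_diff k lab hb (i' := i + -1 + -1) (j' := j + -1 + -1) hij
      (by lia) (by lia)).trans ?_
    -- The differential of `L` has the sign of one shift and `ι_d` asks for that of another; the two
    -- cancel, as they must for ⟦D⁺⟧[2].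
    change _ = -(((-1 : ℤ).negOnePow • S.mat k (S.diff k _)) ≫ _)
    rw [Int.negOnePow_neg, Int.negOnePow_one, Units.neg_smul, one_smul, Preadditive.neg_comp,
      neg_neg]
  ι_ρ i := S.mat_incl_comp_retr k lab hb (by lia)
  σ_π i := S.mat_sect_comp_proj k lab hb
  decomp i := S.mat_retr_comp_incl_add k lab hb (by lia)
  σ_d_ρ i j h := by
    subst h
    refine (S.mat_sect_comp_diff_comp_retr k lab hb (by lia) (by lia)).trans ?_
    exact (Category.comp_id _).symm

/-- In each degree this is `ι_iso`. Comparing two shifts by `-1` with one by `-2` is a mere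
re-indexing, absorbed by the inclusion matrix. -/
lemma incl_comp_iso (hb : lab b = .double) :
    S.incl k lab b hb ≫ (S.coneSplitting k lab hb).iso.hom =
      (shiftFunctorAdd' (CochainComplex (Cob k Y₀ Y₁) ℤ) (-1) (-1) (-2) (by norm_num)).hom.app
        (S.bracket k (Function.update lab b .pos)) ≫
          (CochainComplex.mappingCone.inr (S.genusOneMap k lab b hb))⟦(-1 : ℤ)⟧' := by
  ext i : 1
  rw [HomologicalComplex.comp_f, HomologicalComplex.comp_f,
    CochainComplex.shiftFunctorAdd'_hom_app_f']
  change S.mat k (S.inclEntry k lab b hb) ≫ ((S.coneSplitting k lab hb).XIso i).hom =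
    _ ≫ (CochainComplex.mappingCone.inr (S.genusOneMap k lab b hb)).f (i + -1)
  refine Eq.trans ?_ ((Category.assoc _ _ _).trans
    (congrArg (_ ≫ ·) ((S.coneSplitting k lab hb).ι_iso i)))
  exact congrArg (· ≫ ((S.coneSplitting k lab hb).XIso i).hom)
    (S.XIsoOfEq_bracket_comp_mat k _ (by lia) _).symm

/-- In each degree this is `iso_coneProj`, where the sign has already disappeared; `shiftShiftNeg`
undoes the re-indexing that remains there. -/
lemma iso_comp_coneProj (hb : lab b = .double) :
    (S.coneSplitting k lab hb).iso.hom ≫ (coneProj (S.genusOneMap k lab b hb))⟦(-1 : ℤ)⟧' ≫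
      (shiftShiftNeg (S.bracket k (Function.update lab b .neg)) (1 : ℤ)).hom =
        S.proj k lab b hb := by
  ext i : 1
  have h := (S.coneSplitting k lab hb).iso_coneProj i
  change ((S.coneSplitting k lab hb).XIso i).hom ≫
    (coneProj (S.genusOneMap k lab b hb)).f (i + -1) ≫ _ = (S.proj k lab b hb).f i
  refine (Category.assoc _ _ _).symm.trans ((congrArg (· ≫ _) h).trans
    ((Category.assoc _ _ _).trans (Eq.trans ?_ (Category.comp_id _))))
  refine congrArg ((S.proj k lab b hb).f i ≫ ·) ?_
  -- Unfolded to components, `shiftShiftNeg` is a transport between equal degrees, inverse to the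
  -- one coming from `h`.
  simp only [shiftShiftNeg, shiftEquiv, shiftEquiv', shiftFunctorCompIsoId, Iso.symm_hom, Iso.app_hom,
    Iso.symm_symm_eq, Iso.trans_hom, NatTrans.comp_app, HomologicalComplex.comp_f]
  rw [CochainComplex.shiftFunctorAdd'_inv_app_f', CochainComplex.shiftFunctorZero_hom_app_f]
  simp

end Shadow

end UKh

namespace UKh

/-! ### Distinguished triangles, long exact sequences and the Grothendieck group. -/

section Triangle

variable {C : Type*} [Category C] [Preadditive C] [Limits.HasBinaryBiproducts C]

/-- The isomorphism of mapping cones induced by an isomorphism of the targets. -/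
noncomputable def mappingConeCompIso {K L M : CochainComplex C ℤ} (φ : K ⟶ L) (e : L ≅ M) :
    CochainComplex.mappingCone φ ≅ CochainComplex.mappingCone (φ ≫ e.hom) where
  hom := CochainComplex.mappingCone.map φ (φ ≫ e.hom) (𝟙 _) e.hom (by simp)
  inv := CochainComplex.mappingCone.map (φ ≫ e.hom) φ (𝟙 _) e.inv (by simp)
  hom_inv_id := by
    rw [← CochainComplex.mappingCone.map_comp]
    simp [CochainComplex.mappingCone.map_id]
  inv_hom_id := by
    rw [← CochainComplex.mappingCone.map_comp]
    simp [CochainComplex.mappingCone.map_id]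

variable [Limits.HasZeroObject C]

/-- The last two maps are defined through `e`, so two identities and `e` form an isomorphism with
the standard cone triangle already on the level of complexes. -/
lemma cone_triangle_distinguished {K L B : CochainComplex C ℤ} (φ : K ⟶ L)
    (e : B ≅ CochainComplex.mappingCone φ) :
    (HomotopyCategory.quotient C (ComplexShape.up ℤ)).mapTriangle.obj
      (Pretriangulated.Triangle.mk φ (CochainComplex.mappingCone.inr φ ≫ e.inv)
        (e.hom ≫ coneProj φ)) ∈ Pretriangulated.distinguishedTriangles := by
  refine Pretriangulated.isomorphic_distinguished _
    (HomotopyCategory.mappingCone_triangleh_distinguished φ) _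
    ((HomotopyCategory.quotient C (ComplexShape.up ℤ)).mapTriangle.mapIso
      (Pretriangulated.Triangle.isoMk _ (CochainComplex.mappingCone.triangle φ)
        (Iso.refl _) (Iso.refl _) e
        ((Category.comp_id _).trans (Category.id_comp _).symm) ?_ ?_))
  · exact ((Category.assoc _ _ _).trans ((congrArg (CochainComplex.mappingCone.inr φ ≫ ·)
      e.inv_hom_id).trans (Category.comp_id _))).trans (Category.id_comp _).symm
  · exact (congrArg ((e.hom ≫ coneProj φ) ≫ ·) (CategoryTheory.Functor.map_id _ _)).trans (Category.comp_id _)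

variable {A : Type*} [Category A] [Abelian A] (Z : C ⥤ A) [Z.Additive]

/-- The homology of the image under `Z`, computed in the homotopy category. -/
noncomputable def homologyOfIso (i : ℤ) : HomotopyCategory.quotient C (ComplexShape.up ℤ) ⋙
    Z.mapHomotopyCategory (ComplexShape.up ℤ) ⋙
      HomotopyCategory.homologyFunctor A (ComplexShape.up ℤ) i ≅ homologyOf Z i :=
  (Functor.associator _ _ _).symm ≪≫
    Functor.isoWhiskerRight (Z.mapHomotopyCategoryFactors (ComplexShape.up ℤ)) _ ≪≫
    Functor.associator _ _ _ ≪≫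
    Functor.isoWhiskerLeft _ (HomotopyCategory.homologyFunctorFactors A (ComplexShape.up ℤ) i)

/-- On homotopy categories `Z` preserves distinguished triangles and homology is a homological
functor, which gives the sequence there. The isomorphisms `homologyOfIso` carry it back to
complexes; naturality handles `f` and `g`, and `δ` is defined by conjugation. -/
lemma exists_longExactSequence {X Y W : CochainComplex C ℤ} (f : X ⟶ Y) (g : Y ⟶ W)
    (h : W ⟶ X⟦(1 : ℤ)⟧)
    (hT : (HomotopyCategory.quotient C (ComplexShape.up ℤ)).mapTriangle.obj
      (Pretriangulated.Triangle.mk f g h) ∈ Pretriangulated.distinguishedTriangles) :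
    ∃ δ : ∀ i : ℤ, (homologyOf Z i).obj W ⟶ (homologyOf Z (i + 1)).obj X, ∀ i : ℤ,
      (∃ zero, (ShortComplex.mk ((homologyOf Z i).map f) ((homologyOf Z i).map g) zero).Exact) ∧
      (∃ zero, (ShortComplex.mk ((homologyOf Z i).map g) (δ i) zero).Exact) ∧
      (∃ zero, (ShortComplex.mk (δ i) ((homologyOf Z (i + 1)).map f) zero).Exact) := by
  -- Degree `0` suffices: the shift sequence of this functor consists of the homology functors in
  -- all degrees.
  let F := HomotopyCategory.homologyFunctor A (ComplexShape.up ℤ) 0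
  let T := (Z.mapHomotopyCategory (ComplexShape.up ℤ)).mapTriangle.obj
    ((HomotopyCategory.quotient C (ComplexShape.up ℤ)).mapTriangle.obj
      (Pretriangulated.Triangle.mk f g h))
  have hT' : T ∈ Pretriangulated.distinguishedTriangles :=
    (Z.mapHomotopyCategory (ComplexShape.up ℤ)).map_distinguished _ hT
  let α : ∀ i, _ ≅ _ := homologyOfIso Z
  let δ (i : ℤ) : (homologyOf Z i).obj W ⟶ (homologyOf Z (i + 1)).obj X :=
    (α i).inv.app W ≫ F.homologySequenceδ T i (i + 1) rfl ≫ (α (i + 1)).hom.app X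
  have nat : ∀ (i : ℤ) {P Q : CochainComplex C ℤ} (u : P ⟶ Q),
      (α i).hom.app P ≫ (homologyOf Z i).map u =
        (HomotopyCategory.homologyFunctor A (ComplexShape.up ℤ) i).map
          ((Z.mapHomotopyCategory (ComplexShape.up ℤ)).map
            ((HomotopyCategory.quotient C (ComplexShape.up ℤ)).map u)) ≫ (α i).hom.app Q :=
    fun i _ _ u => ((α i).hom.naturality u).symm
  -- Exactness is moved along isomorphisms, including the vanishing of the composite, which is not
  -- known beforehand for the maps on complexes.
  have transport : ∀ {S : ShortComplex A} (hS : S.Exact) {X₁ X₂ X₃ : A} (u : X₁ ⟶ X₂)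
      (v : X₂ ⟶ X₃) (e₁ : S.X₁ ≅ X₁) (e₂ : S.X₂ ≅ X₂) (e₃ : S.X₃ ≅ X₃),
      e₁.hom ≫ u = S.f ≫ e₂.hom → e₂.hom ≫ v = S.g ≫ e₃.hom →
      ∃ zero, (ShortComplex.mk u v zero).Exact := by
    intro S hS X₁ X₂ X₃ u v e₁ e₂ e₃ hu hv
    have zero : u ≫ v = 0 := by
      rw [← cancel_epi e₁.hom, reassoc_of% hu, hv, S.zero_assoc, Limits.zero_comp, Limits.comp_zero]
    exact ⟨zero, ShortComplex.exact_of_iso (ShortComplex.isoMk e₁ e₂ e₃ hu hv) hS⟩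
  refine ⟨δ, fun i => ⟨?_, ?_, ?_⟩⟩
  · exact transport (F.homologySequence_exact₂ T hT' i) _ _ ((α i).app X) ((α i).app Y)
      ((α i).app W) (nat i f) (nat i g)
  · exact transport (F.homologySequence_exact₃ T hT' i (i + 1) rfl) _ _ ((α i).app Y)
      ((α i).app W) ((α (i + 1)).app X) (nat i g) ((α i).hom_inv_id_app_assoc W _)
  · exact transport (F.homologySequence_exact₁ T hT' i (i + 1) rfl) _ _ ((α i).app W)
      ((α (i + 1)).app X) ((α (i + 1)).app Y) ((α i).hom_inv_id_app_assoc W _) (nat (i + 1) f)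

/-- The triangle itself is one of the defining relations; its vertices are the given complexes by
definition. -/
lemma KGroup.mk_eq_sub {X Y W : CochainComplex C ℤ} (hX : Bounded X)
    (hY : Bounded Y) (hW : Bounded W) (f : X ⟶ Y) (g : Y ⟶ W) (h : W ⟶ X⟦(1 : ℤ)⟧)
    (hT : (HomotopyCategory.quotient C (ComplexShape.up ℤ)).mapTriangle.obj
      (Pretriangulated.Triangle.mk f g h) ∈ Pretriangulated.distinguishedTriangles) :
    KGroup.mk W hW = KGroup.mk Y hY - KGroup.mk X hX := by
  have key : (QuotientAddGroup.mk (FreeAbelianGroup.of ⟨Y, hY⟩ - FreeAbelianGroup.of ⟨X, hX⟩ -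
      FreeAbelianGroup.of ⟨W, hW⟩) : KGroup C) = 0 :=
    (QuotientAddGroup.eq_zero_iff _).2 (AddSubgroup.subset_closure
      ⟨⟨X, hX⟩, ⟨Y, hY⟩, ⟨W, hW⟩, _, hT, rfl, rfl, rfl, rfl⟩)
  exact (sub_eq_zero.1 key).symm

end Triangle

/-! ### Normalising shifts and the Khovanov complex. -/

namespace SingDiagram

universe u

variable {l l' : List Bool} (D : SingDiagram l l') (k : Type u) [CommRing k] {b : D.shape.V}

/-- A double point counts 2 and a negative crossing 1 in n₋ + 2n_×. The difference of one
compensates the shift of the cone in `bracketIso`. -/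
lemma weight_resolve_neg (hb : D.label b = .double) :
    -1 + D.weight = (D.resolve b .neg).weight := by
  classical
  let := D.order
  have count_eq : ∀ y : Label, ((D.resolve b .neg).count y : ℤ) = D.count y +
      (if Label.neg = y then 1 else 0) - (if y = .double then 1 else 0) := by
    intro y
    have h₁ : (D.resolve b .neg).count y = (Finset.univ.filter
        (fun v => Function.update D.label b .neg v = y)).card :=
      (Nat.card_eq_fintype_card (α := {v // Function.update D.label b .neg v = y})).trans
        (Fintype.card_subtype _)
    have h₂ : D.count y = (Finset.univ.filter (fun v => D.label v = y)).card :=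
      (Nat.card_eq_fintype_card (α := {v // D.label v = y})).trans (Fintype.card_subtype _)
    -- The contribution of `b` is split off from both counts; the labels of the other vertices
    -- agree.
    rw [h₁, h₂, Finset.card_filter, Finset.card_filter,
      ← Finset.add_sum_erase _ _ (Finset.mem_univ b),
      ← Finset.add_sum_erase _ (fun v => if D.label v = y then 1 else 0) (Finset.mem_univ b),
      Finset.sum_congr rfl (g := fun v => if D.label v = y then 1 else 0)
        (fun v hv => by rw [Function.update_of_ne (Finset.ne_of_mem_erase hv)]),
      Function.update_self, hb]
    push_cast
    simp only [eq_comm (a := Label.double)]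
    ring
  unfold weight
  rw [count_eq, count_eq]
  simp
  ring

/-- The bracket complex is the shifted mapping cone of the genus-one morphism. -/
noncomputable def bracketIso (hb : D.label b = .double) (c : Bool) :
    D.bracket k c ≅ (CochainComplex.mappingCone (D.genusOne k hb c))⟦(-1 : ℤ)⟧ :=
  letI := D.order
  ((D.shape.shadow c).coneSplitting k D.label hb).iso

/-- The universal Khovanov complex is the mapping cone of the genus-one morphism. -/
noncomputable def KhIso (hb : D.label b = .double) :
    D.Kh k ≅ CochainComplex.mappingCone (D.KhGenusOne k hb) :=
  (shiftFunctor _ D.weight).mapIso (D.bracketIso k hb true) ≪≫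
    -- The shift of the cone and the normalisation of `D` combine to the normalisation of D⁻, under
    -- which the cone becomes that of the shifted genus-one morphism.
    ((shiftFunctorAdd' (CochainComplex (Cob k (bdry true l) (bdry true l')) ℤ) (-1) D.weight
      (D.resolve b .neg).weight (D.weight_resolve_neg hb)).app _).symm ≪≫
    CochainComplex.mappingCone.shiftIso _ _ ≪≫
    -- `KhGenusOne` is that shifted morphism followed by this identification of its target with
    -- Kh(D⁺).
    mappingConeCompIso _ ((shiftFunctorAdd' _ (-1) (D.resolve b .neg).weight
      (D.resolve b .pos).weight (weight_resolve hb)).app _).symm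

end SingDiagram

end UKh

theorem corollary5p3 {k : Type*} [CommRing k] {l l' : List Bool}
    (D : UKh.SingDiagram l l') (b : D.shape.V) (hb : D.label b = .double) :
    -- the bracket complex is the shifted mapping cone, compatibly with `⟦D⁺⟧[2] → ⟦D⟧ → ⟦D⁻⟧`
    (∀ c : Bool, ∃ θ : D.bracket k c ≅ (CochainComplex.mappingCone (D.genusOne k hb c))⟦(-1 : ℤ)⟧,
      D.incl k hb c ≫ θ.hom =
        (shiftFunctorAdd' (CochainComplex (UKh.Cob k (UKh.bdry c l) (UKh.bdry c l')) ℤ)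
          (-1) (-1) (-2) (by norm_num)).hom.app ((D.resolve b .pos).bracket k c) ≫
            (CochainComplex.mappingCone.inr (D.genusOne k hb c))⟦(-1 : ℤ)⟧' ∧
      θ.hom ≫ (UKh.coneProj (D.genusOne k hb c))⟦(-1 : ℤ)⟧' ≫
        (shiftShiftNeg ((D.resolve b .neg).bracket k c) (1 : ℤ)).hom = D.proj k hb c) ∧
    -- the universal Khovanov complex is the mapping cone of the genus-one morphism
    (∃ e : D.Kh k ≅ CochainComplex.mappingCone (D.KhGenusOne k hb),
      -- the distinguished triangle
      (HomotopyCategory.quotient _ (ComplexShape.up ℤ)).mapTriangle.obj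
        (Pretriangulated.Triangle.mk (D.KhGenusOne k hb)
          (CochainComplex.mappingCone.inr (D.KhGenusOne k hb) ≫ e.inv)
          (e.hom ≫ UKh.coneProj (D.KhGenusOne k hb))) ∈ Pretriangulated.distinguishedTriangles ∧
      -- the long exact sequence in homology
      ∀ (A : Type*) [Category A] [Abelian A]
        (Z : UKh.Cob k (UKh.bdry true l) (UKh.bdry true l') ⥤ A) [Z.Additive],
        ∃ δ : ∀ i : ℤ, (UKh.homologyOf Z i).obj (D.Kh k) ⟶
            (UKh.homologyOf Z (i + 1)).obj ((D.resolve b .neg).Kh k),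
          ∀ i : ℤ,
            (∃ zero, (ShortComplex.mk ((UKh.homologyOf Z i).map (D.KhGenusOne k hb))
              ((UKh.homologyOf Z i).map
                (CochainComplex.mappingCone.inr (D.KhGenusOne k hb) ≫ e.inv)) zero).Exact) ∧
            (∃ zero, (ShortComplex.mk
              ((UKh.homologyOf Z i).map
                (CochainComplex.mappingCone.inr (D.KhGenusOne k hb) ≫ e.inv)) (δ i) zero).Exact) ∧
            (∃ zero, (ShortComplex.mk (δ i)
              ((UKh.homologyOf Z (i + 1)).map (D.KhGenusOne k hb)) zero).Exact)) ∧
    -- the Vassiliev skein relation in the `K`-group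
    D.KhClass k = (D.resolve b .pos).KhClass k - (D.resolve b .neg).KhClass k := by
  -- This one triangle yields the triangle claim, the long exact sequences and the skein relation.
  have hT := UKh.cone_triangle_distinguished (D.KhGenusOne k hb) (D.KhIso k hb)
  refine ⟨fun c => ⟨D.bracketIso k hb c, ?_, ?_⟩, ⟨D.KhIso k hb, hT, ?_⟩, ?_⟩
  · let := D.order
    exact (D.shape.shadow c).incl_comp_iso k D.label hb
  · let := D.order
    exact (D.shape.shadow c).iso_comp_coneProj k D.label hb
  · intro A _ _ Z _
    exact UKh.exists_longExactSequence Z _ _ _ hT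
  · exact UKh.KGroup.mk_eq_sub _ _ _ _ _ _ hT
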